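/- Let $N\ge 1$ and let $J\in C(\mathbb R^N,\mathbb R)$ be nonnegative, spherically symmetric and radially decreasing (in the wide sense), with $J(0)>0$ and $\int_{\mathbb R^N}J(x)\,dx=1$. For a bounded open set $\Omega\subset\mathbb R^N$ consider the nonlocal Dirichlet eigenvalue problem $$ \int_{\mathbb R^N}J(x-y)u(y)\,dy-u(x)=-\lambda\,u(x)\ \text{ for (almost every) } x\in\Omega,\qquad u=0\ \text{ in }\mathbb R^N\setminus\Omega,\qquad 0\ne u\in L^2(\mathbb R^N). $$ Its eigenvalues are $\lambda_i(\Omega)=1-\mu_i(\Omega)$, where $\mu_i(\Omega)$ are the eigenvalues, repeated according to multiplicity and enumerated in decreasing order of magnitude $|\mu_1|\ge|\mu_2|\ge\cdots$, of the compact self-adjoint operator $\mathcal J_\Omega u(x)=\int_\Omega J(x-y)u(y)\,dy$ on $L^2(\Omega)$ (if $\mathcal J_\Omega$ has rank one, then $\mu_2(\Omega)=0$; if distinct eigenvalues have the same magnitude, what follows holds for every admissible enumeration). Let $c>0$. Every bounded open set $\Omega\subset\mathbb R^N$ with $|\Omega|=c$ has a second eigenvalue $\lambda_2(\Omega)$,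 and the infimum $$ m=\inf\{\lambda_2(\Omega):\ \Omega\subset\mathbb R^N \text{ bounded and open},\ |\Omega|=c\} $$ is attained in the limit by two disjoint identical balls whose mutual distance tends to infinity: if $r>0$ is the radius for which a ball of radius $r$ has volume $c/2$, then $$ \lim_{|a-b|\to\infty}\lambda_2\bigl(B(a,r)\cup B(b,r)\bigr)=m . $$ That is, for every $\varepsilon>0$ there is $R\ge 2r$ such that $|\lambda_2(B(a,r)\cup B(b,r))-m|<\varepsilon$ for all $a,b\in\mathbb R^N$ with $|a-b|\ge R$. -/

import Mathlib

open MeasureTheory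

/-- Hypothesis (H) on the kernel: `J` is continuous, nonnegative, spherically symmetric, radially
decreasing (in the wide sense), positive at the origin, and has integral one.
(As the Bochner integral of a non-integrable function is `0`, the last field includes
integrability.) -/
structure HypothesisH {N : ℕ} (J : EuclideanSpace ℝ (Fin N) → ℝ) : Prop where
  continuous : Continuous J
  nonneg : ∀ x, 0 ≤ J x
  radial : ∀ x y, ‖x‖ = ‖y‖ → J x = J y
  radially_decreasing : ∀ x y, ‖x‖ ≤ ‖y‖ → J y ≤ J x
  pos_zero : 0 < J 0
  integral_eq_one : ∫ x, J x = 1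

/-- `u` is an eigenfunction, with eigenvalue `lam`, of the nonlocal Dirichlet problem
`(J * u)(x) - u(x) = - lam * u(x)` for `x ∈ Ω`, `u = 0` outside `Ω`,
where `u` is a nonzero element of `L²(ℝᴺ)`. -/
structure IsEigenfunction {N : ℕ} (J : EuclideanSpace ℝ (Fin N) → ℝ)
    (Ω : Set (EuclideanSpace ℝ (Fin N))) (u : EuclideanSpace ℝ (Fin N) → ℝ) (lam : ℝ) : Prop where
  memLp : MemLp u 2 volume
  eq_zero_of_notMem : ∀ x, x ∉ Ω → u x = 0
  ne_zero : ¬ (u =ᵐ[volume] 0)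
  equation : ∀ᵐ x ∂(volume.restrict Ω), (∫ y, J (x - y) * u y) - u x = - lam * u x

/-- `lam₂` is a second eigenvalue `λ₂(Ω)` of the nonlocal Dirichlet problem. The eigenvalues are
`λᵢ = 1 - μᵢ`, where the `μᵢ` are the eigenvalues of the convolution operator
`u ↦ (J * u)|_Ω` on `L²(Ω)`, repeated according to multiplicity and
enumerated in decreasing order of magnitude, `|μ₁| ≥ |μ₂| ≥ …`. Thus there are orthogonal
eigenfunctions `u₁`, `u₂` for `λ₁`, `λ₂` with `|1 - λ₁| ≥ |1 - λ₂|`, and every eigenvalue `lam` with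
an eigenfunction orthogonal to both satisfies `|1 - λ₂| ≥ |1 - lam|`. If distinct eigenvalues
have the same magnitude, every admissible enumeration is allowed. -/
def IsSecondEigenvalue {N : ℕ} (J : EuclideanSpace ℝ (Fin N) → ℝ)
    (Ω : Set (EuclideanSpace ℝ (Fin N))) (lam₂ : ℝ) : Prop :=
  ∃ (u₁ u₂ : EuclideanSpace ℝ (Fin N) → ℝ) (lam₁ : ℝ),
    IsEigenfunction J Ω u₁ lam₁ ∧ IsEigenfunction J Ω u₂ lam₂ ∧
    ∫ x, u₁ x * u₂ x = 0 ∧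
    |1 - lam₂| ≤ |1 - lam₁| ∧
    ∀ (v : EuclideanSpace ℝ (Fin N) → ℝ) (lam : ℝ), IsEigenfunction J Ω v lam →
      ∫ x, u₁ x * v x = 0 → ∫ x, u₂ x * v x = 0 → |1 - lam| ≤ |1 - lam₂|

/-- Bounded open subsets of `ℝᴺ` of volume `c`. -/
def IsAdmissible {N : ℕ} (c : ℝ) (Ω : Set (EuclideanSpace ℝ (Fin N))) : Prop :=
  IsOpen Ω ∧ Bornology.IsBounded Ω ∧ volume Ω = ENNReal.ofReal c

/-! Write `μ = 1 - lam` and let `Q(f) = kernelForm J f f`. Let `κ` be the top eigenvalue of the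
convolution operator on a ball `B` of volume `c / 2`. The infimum is `1 - κ`: no admissible `Ω` has
`μ₂ > κ`, and two distant balls almost reach `μ₂ = κ`.

Upper bound on `μ₂`. The nonlocal Faber–Krahn inequality (`kernelForm_le_of_volume_le_ball`) says
`Q(f) ≤ κ ∫ f²` for suitable `f ≥ 0` whose positivity set has volume at most `|B|`. Testing the
eigenvalue equation with `u⁺` gives `μ ∫ (u⁺)² ≤ Q(u⁺)`. So an eigenfunction with `μ > κ` that is
somewhere positive is positive on more than half of `Ω`; applied to `u` and `-u` this forces a
constant sign. If `μ₁ ≥ μ₂ > κ`, two nonnegative orthogonal eigenfunctions would have essentially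
disjoint positivity sets, each larger than half of `Ω`, which is absurd. The enumeration is by
modulus, so `μ₁ < 0` must also be excluded: `Q(|u|) > -Q(u)` would produce an eigenvalue of modulus
larger than `|μ₁|`.

Faber–Krahn. It is proved by polarization and compactness. Reflecting in a hyperplane and moving the
larger values to the side of the origin preserves `∫ f²` and the volume of positivity and does not
decrease `Q`. In a compact class of Lipschitz functions stable under this operation, a minimizer of
`∫ |x|² g²` must be radially decreasing, hence supported in `B`. Approximation from below by
inf-convolution extends the inequality to lower semicontinuous functions.

Two balls. As `J` tends to `0` at infinity, the interaction of distant balls is a small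
perturbation. Min-max on two translates of the ground state of `B` yields `|μ₂| ≥ κ - o(1)`. A
negative `μ₂` is impossible because the spectrum on one ball stays above `-(κ - δ)` for some `δ >
0`. -/

section KernelForm

variable {N : ℕ}

local notation "𝔼" => EuclideanSpace ℝ (Fin N)

/-! ### Elementary properties of the kernel. -/

namespace HypothesisH

variable {J : EuclideanSpace ℝ (Fin N) → ℝ}

theorem le_zero (hJ : HypothesisH J) (x : 𝔼) : J x ≤ J 0 :=
  hJ.radially_decreasing 0 x (by simp)

theorem norm_le (hJ : HypothesisH J) (x : 𝔼) : ‖J x‖ ≤ J 0 := by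
  rw [Real.norm_of_nonneg (hJ.nonneg x)]; exact hJ.le_zero x

theorem sub_comm (hJ : HypothesisH J) (x y : 𝔼) : J (x - y) = J (y - x) :=
  hJ.radial _ _ (norm_sub_rev x y)

theorem integrable (hJ : HypothesisH J) : Integrable J := by
  by_contra h
  have := hJ.integral_eq_one
  rw [integral_undef h] at this
  exact zero_ne_one this

/-- By monotonicity, values above `ε` arbitrarily far out would force `J ≥ ε` everywhere, which
contradicts integrability since the space has infinite measure for `N ≥ 1`. -/
theorem exists_forall_le (hJ : HypothesisH J) (hN : 1 ≤ N) {ε : ℝ} (hε : 0 < ε) :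
    ∃ R, ∀ x : 𝔼, R ≤ ‖x‖ → J x ≤ ε := by
  by_contra! h
  have hlt : ∀ y, ε ≤ J y := fun y => by
    obtain ⟨x, hx, hx'⟩ := h ‖y‖
    exact hx'.le.trans (hJ.radially_decreasing y x hx)
  have hint : Integrable (fun _ : 𝔼 => ε) :=
    hJ.integrable.mono' aestronglyMeasurable_const
      (.of_forall fun x => by rw [Real.norm_of_nonneg hε.le]; exact hlt x)
  rw [integrable_const_iff] at hint
  rcases hint with h0 | h1
  · exact hε.ne' h0
  · have : Nonempty (Fin N) := ⟨⟨0, hN⟩⟩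
    have : Nontrivial 𝔼 := inferInstance
    have := h1.measure_univ_lt_top
    rw [measure_univ_of_isAddLeftInvariant] at this
    exact lt_irrefl _ this

theorem uniformContinuous (hJ : HypothesisH J) (hN : 1 ≤ N) : UniformContinuous J := by
  refine hJ.continuous.uniformContinuous_of_tendsto_cocompact (x := 0) ?_
  rw [Metric.tendsto_nhds]
  intro ε hε
  obtain ⟨R, hR⟩ := hJ.exists_forall_le hN (half_pos hε)
  filter_upwards [(tendsto_norm_cocompact_atTop (E := 𝔼)).eventually_ge_atTop R] with x hx
  rw [Real.dist_0_eq_abs, abs_of_nonneg (hJ.nonneg x)]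
  linarith [hR x hx]

end HypothesisH

/-- The bilinear form `∬ f(x) J(x - y) g(y) dx dy`. -/
noncomputable def kernelForm (J f g : 𝔼 → ℝ) : ℝ :=
  ∫ p : 𝔼 × 𝔼, f p.1 * J (p.1 - p.2) * g p.2

/-! ### Algebra of the bilinear form, and square-integrable functions supported in a set. -/

variable {J f g h : EuclideanSpace ℝ (Fin N) → ℝ}

theorem HypothesisH.integrable_kernel (hJ : HypothesisH J) (hf : Integrable f) (hg : Integrable g) :
    Integrable (fun p : 𝔼 × 𝔼 => f p.1 * J (p.1 - p.2) * g p.2) := by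
  have h1 : Integrable (fun p : 𝔼 × 𝔼 => f p.1 * g p.2) := hf.mul_prod hg
  have hc : Continuous fun p : 𝔼 × 𝔼 => J (p.1 - p.2) :=
    hJ.continuous.comp (continuous_fst.sub continuous_snd)
  refine (h1.bdd_mul (c := J 0) hc.aestronglyMeasurable
    (.of_forall fun p => hJ.norm_le _)).congr (.of_forall fun p => ?_)
  simp only
  ring

theorem kernelForm_eq_integral (hJ : HypothesisH J) (hf : Integrable f) (hg : Integrable g) :
    kernelForm J f g = ∫ x, f x * ∫ y, J (x - y) * g y := by
  have := integral_prod _ (hJ.integrable_kernel hf hg)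
  rw [kernelForm, ← Measure.volume_eq_prod] at *
  rw [this]
  refine integral_congr_ae (.of_forall fun x => ?_)
  simp only
  rw [← integral_const_mul]
  simp only [mul_assoc]

theorem kernelForm_comm (hJ : HypothesisH J) (f g : 𝔼 → ℝ) :
    kernelForm J f g = kernelForm J g f := by
  unfold kernelForm
  rw [Measure.volume_eq_prod, ← integral_prod_swap]
  refine integral_congr_ae (.of_forall fun p => ?_)
  simp only [Prod.fst_swap, Prod.snd_swap]
  rw [hJ.sub_comm]; ring

theorem kernelForm_smul_left (a : ℝ) (f g : 𝔼 → ℝ) :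
    kernelForm J (fun x => a * f x) g = a * kernelForm J f g := by
  unfold kernelForm
  rw [← integral_const_mul]
  simp only [mul_assoc]

theorem kernelForm_smul_right (a : ℝ) (f g : 𝔼 → ℝ) :
    kernelForm J f (fun x => a * g x) = a * kernelForm J f g := by
  unfold kernelForm
  rw [← integral_const_mul]
  refine integral_congr_ae (.of_forall fun p => ?_)
  simp only; ring

theorem kernelForm_add_left (hJ : HypothesisH J) (hf : Integrable f) (hg : Integrable g)
    (hh : Integrable h) :
    kernelForm J (fun x => f x + g x) h = kernelForm J f h + kernelForm J g h := by
  unfold kernelForm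
  rw [← integral_add (hJ.integrable_kernel hf hh) (hJ.integrable_kernel hg hh)]
  refine integral_congr_ae (.of_forall fun p => ?_)
  simp only; ring

theorem kernelForm_add_right (hJ : HypothesisH J) (hf : Integrable f) (hg : Integrable g)
    (hh : Integrable h) :
    kernelForm J f (fun x => g x + h x) = kernelForm J f g + kernelForm J f h := by
  rw [kernelForm_comm hJ, kernelForm_add_left hJ hg hh hf, kernelForm_comm hJ g,
    kernelForm_comm hJ h]

theorem kernelForm_lin_comb_self (hJ : HypothesisH J) (hf : Integrable f) (hg : Integrable g)
    (a b : ℝ) :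
    kernelForm J (fun x => a * f x + b * g x) (fun x => a * f x + b * g x) =
      a ^ 2 * kernelForm J f f + 2 * (a * b) * kernelForm J f g + b ^ 2 * kernelForm J g g := by
  have haf : Integrable fun x => a * f x := hf.const_mul a
  have hbg : Integrable fun x => b * g x := hg.const_mul b
  rw [kernelForm_add_left hJ haf hbg (show Integrable fun x => a * f x + b * g x from haf.add hbg), kernelForm_add_right hJ haf haf hbg,
    kernelForm_add_right hJ hbg haf hbg]
  simp only [kernelForm_smul_left, kernelForm_smul_right]
  rw [kernelForm_comm hJ g f]
  ring

theorem kernelForm_congr_ae {f' g' : 𝔼 → ℝ} (hf : f =ᵐ[volume] f') (hg : g =ᵐ[volume] g') :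
    kernelForm J f g = kernelForm J f' g' := by
  unfold kernelForm
  refine integral_congr_ae ?_
  have h1 : ∀ᵐ p : 𝔼 × 𝔼, f p.1 = f' p.1 := Measure.quasiMeasurePreserving_fst.ae hf
  have h2 : ∀ᵐ p : 𝔼 × 𝔼, g p.2 = g' p.2 := Measure.quasiMeasurePreserving_snd.ae hg
  filter_upwards [h1, h2] with p hp1 hp2
  rw [hp1, hp2]

theorem kernelForm_nonneg (hJ : HypothesisH J) (hf : ∀ x, 0 ≤ f x) (hg : ∀ x, 0 ≤ g x) :
    0 ≤ kernelForm J f g :=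
  integral_nonneg fun _ => mul_nonneg (mul_nonneg (hf _) (hJ.nonneg _)) (hg _)

theorem kernelForm_mono (hJ : HypothesisH J) {f' g' : 𝔼 → ℝ} (hf : Integrable f)
    (hg : Integrable g) (hf' : Integrable f') (hg' : Integrable g')
    (hf0 : ∀ x, 0 ≤ f x) (hg0 : ∀ x, 0 ≤ g x)
    (hff : ∀ x, f x ≤ f' x) (hgg : ∀ x, g x ≤ g' x) :
    kernelForm J f g ≤ kernelForm J f' g' := by
  refine integral_mono (hJ.integrable_kernel hf hg) (hJ.integrable_kernel hf' hg') fun p => ?_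
  have h1 := hJ.nonneg (p.1 - p.2)
  have h2 := (hf0 p.1).trans (hff p.1)
  simp only
  gcongr
  · exact hg0 _
  · exact hff _
  · exact hgg _

theorem kernelForm_translate (f g : 𝔼 → ℝ) (a : 𝔼) :
    kernelForm J (fun x => f (x + a)) (fun x => g (x + a)) = kernelForm J f g := by
  unfold kernelForm
  rw [Measure.volume_eq_prod,
    ← integral_add_right_eq_self (fun p : 𝔼 × 𝔼 => f p.1 * J (p.1 - p.2) * g p.2) (a, a)]
  simp

/-- Square-integrable functions vanishing outside `Ω`. -/
structure SupportedL2 (Ω : Set 𝔼) (f : 𝔼 → ℝ) : Prop where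
  memLp : MemLp f 2 volume
  eq_zero_of_notMem : ∀ x, x ∉ Ω → f x = 0

theorem IsEigenfunction.supportedL2 {Ω : Set 𝔼} {u : 𝔼 → ℝ} {lam : ℝ}
    (hu : IsEigenfunction J Ω u lam) : SupportedL2 Ω u :=
  ⟨hu.memLp, hu.eq_zero_of_notMem⟩

namespace SupportedL2

variable {Ω Ω' : Set (EuclideanSpace ℝ (Fin N))}

theorem mono (hf : SupportedL2 Ω f) (hΩ : Ω ⊆ Ω') : SupportedL2 Ω' f :=
  ⟨hf.memLp, fun x hx => hf.eq_zero_of_notMem x fun h => hx (hΩ h)⟩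

theorem const_mul (hf : SupportedL2 Ω f) (a : ℝ) : SupportedL2 Ω (fun x => a * f x) :=
  ⟨hf.memLp.const_mul a, fun x hx => by simp [hf.eq_zero_of_notMem x hx]⟩

theorem add (hf : SupportedL2 Ω f) (hg : SupportedL2 Ω g) : SupportedL2 Ω (fun x => f x + g x) :=
  ⟨hf.memLp.add hg.memLp, fun x hx => by
    simp [hf.eq_zero_of_notMem x hx, hg.eq_zero_of_notMem x hx]⟩

theorem abs (hf : SupportedL2 Ω f) : SupportedL2 Ω (fun x => |f x|) :=
  ⟨hf.memLp.abs, fun x hx => by simp [hf.eq_zero_of_notMem x hx]⟩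

theorem max_zero (hf : SupportedL2 Ω f) : SupportedL2 Ω (fun x => max (f x) 0) :=
  ⟨hf.memLp.pos_part, fun x hx => by simp [hf.eq_zero_of_notMem x hx]⟩

theorem max_neg_zero (hf : SupportedL2 Ω f) : SupportedL2 Ω (fun x => max (-f x) 0) :=
  ⟨hf.memLp.neg_part, fun x hx => by simp [hf.eq_zero_of_notMem x hx]⟩

theorem indicator (hf : MemLp f 2 volume) (hΩ : MeasurableSet Ω) :
    SupportedL2 Ω (Ω.indicator f) :=
  ⟨hf.indicator hΩ, fun _ hx => Set.indicator_of_notMem hx f⟩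

theorem integrable (hf : SupportedL2 Ω f) (hΩ : Bornology.IsBounded Ω) : Integrable f := by
  obtain ⟨R, hR⟩ := hΩ.subset_closedBall 0
  have : IsFiniteMeasure (volume.restrict (Metric.closedBall (0 : 𝔼) R)) :=
    ⟨by rw [Measure.restrict_apply_univ]; exact measure_closedBall_lt_top⟩
  have h1 : IntegrableOn f (Metric.closedBall (0 : 𝔼) R) :=
    (hf.memLp.restrict _).integrable (by norm_num)
  exact (integrableOn_iff_integrable_of_support_subset fun x hx => by
    by_contra h
    exact hx (hf.eq_zero_of_notMem x fun h' => h (hR h'))).1 h1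

theorem integrable_mul (hf : SupportedL2 Ω f) (hg : SupportedL2 Ω' g) :
    Integrable (fun x => f x * g x) :=
  hf.memLp.integrable_mul hg.memLp

theorem integral_mul_self_pos (hf : SupportedL2 Ω f) (h0 : ¬ f =ᵐ[volume] 0) :
    0 < ∫ x, f x * f x := by
  refine lt_of_le_of_ne (integral_nonneg fun _ => mul_self_nonneg _) fun h => h0 ?_
  have := (integral_eq_zero_iff_of_nonneg (fun x => mul_self_nonneg (f x))
    (hf.integrable_mul hf)).1 h.symm
  filter_upwards [this] with x hx
  simpa using hx

theorem translate (hf : SupportedL2 Ω f) (a : 𝔼) :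
    SupportedL2 ((fun x => x + a) ⁻¹' Ω) (fun x => f (x + a)) :=
  ⟨hf.memLp.comp_measurePreserving (measurePreserving_add_right volume a),
    fun _ hx => hf.eq_zero_of_notMem _ hx⟩

theorem integral_lin_comb_self (hf : SupportedL2 Ω f) (hg : SupportedL2 Ω' g) (a b : ℝ) :
    ∫ x, (a * f x + b * g x) * (a * f x + b * g x) =
      a ^ 2 * (∫ x, f x * f x) + 2 * (a * b) * (∫ x, f x * g x) + b ^ 2 * ∫ x, g x * g x := by
  have h1 := (hf.integrable_mul hf).const_mul (a ^ 2)
  have h2 := (hf.integrable_mul hg).const_mul (2 * (a * b))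
  have h3 := (hg.integrable_mul hg).const_mul (b ^ 2)
  have h12 : Integrable fun x => a ^ 2 * (f x * f x) + 2 * (a * b) * (f x * g x) := h1.add h2
  rw [← integral_const_mul, ← integral_const_mul, ← integral_const_mul,
    ← integral_add h1 h2, ← integral_add h12 h3]
  refine integral_congr_ae (.of_forall fun x => ?_)
  ring

theorem integral_lin_comb (hf : SupportedL2 Ω f) (hg : SupportedL2 Ω g) (hh : SupportedL2 Ω' h)
    (a b : ℝ) :
    ∫ x, h x * (a * f x + b * g x) = a * (∫ x, h x * f x) + b * ∫ x, h x * g x := by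
  rw [← integral_const_mul, ← integral_const_mul,
    ← integral_add ((hh.integrable_mul hf).const_mul a) ((hh.integrable_mul hg).const_mul b)]
  refine integral_congr_ae (.of_forall fun x => ?_)
  simp only; ring

end SupportedL2

end KernelForm

/-! ### Compactness of the convolution operator on `L²(Ω)`. -/

section ConvolutionOperator

variable {N : ℕ}

local notation "𝔼" => EuclideanSpace ℝ (Fin N)

variable {J f g h : EuclideanSpace ℝ (Fin N) → ℝ} {Ω : Set (EuclideanSpace ℝ (Fin N))}

open scoped BoundedContinuousFunction InnerProductSpace

/-- The bounded continuous function `y ↦ J (x - y)`. -/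
noncomputable def HypothesisH.kernel (hJ : HypothesisH J) (x : 𝔼) : 𝔼 →ᵇ ℝ :=
  BoundedContinuousFunction.ofNormedAddCommGroup (fun y => J (x - y))
    (hJ.continuous.comp (continuous_const.sub continuous_id)) (J 0) fun _ => hJ.norm_le _

theorem HypothesisH.continuous_kernel (hJ : HypothesisH J) (hN : 1 ≤ N) :
    Continuous hJ.kernel := by
  rw [Metric.continuous_iff]
  intro x ε hε
  obtain ⟨δ, hδ, h⟩ := Metric.uniformContinuous_iff.1 (hJ.uniformContinuous hN) (ε / 2) (half_pos hε)
  refine ⟨δ, hδ, fun y hy => lt_of_le_of_lt ?_ (half_lt_self hε)⟩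
  refine (BoundedContinuousFunction.dist_le (half_pos hε).le).2 fun z => (h ?_).le
  simpa [dist_eq_norm] using hy

/-- Radial projection. It extends continuous functions from a compact ball to the whole space, where
they can be mapped into `L²(Ω)`. -/
theorem exists_retraction_closedBall {R : ℝ} (hR : 0 < R) :
    ∃ ρ : C(𝔼, Metric.closedBall (0 : 𝔼) R), ∀ x : 𝔼, ‖x‖ ≤ R → (ρ x : 𝔼) = x := by
  have hpos : ∀ x : 𝔼, 0 < max R ‖x‖ := fun x => lt_max_of_lt_left hR
  refine ⟨⟨fun x => ⟨(R / max R ‖x‖) • x, ?_⟩, ?_⟩, fun x hx => ?_⟩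
  · rw [mem_closedBall_zero_iff, norm_smul, Real.norm_of_nonneg (div_pos hR (hpos x)).le,
      div_mul_eq_mul_div, div_le_iff₀ (hpos x)]
    exact mul_le_mul_of_nonneg_left (le_max_right _ _) hR.le
  · refine Continuous.subtype_mk ?_ _
    exact (continuous_const.div (continuous_const.max continuous_norm)
      fun x => (hpos x).ne').smul continuous_id
  · simp [max_eq_left hx, div_self hR.ne']

/-- The operator factors through continuous functions on a closed ball containing `Ω`, as `u ↦ (x ↦
⟪J(x - ·), u⟫)`. Since `x ↦ J(x - ·)` is continuous into `L²(Ω)`, the image of the unit ball is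
bounded and equicontinuous, and Arzelà–Ascoli applies. -/
theorem exists_convolution_operator (hJ : HypothesisH J) (hN : 1 ≤ N)
    (hΩ : Bornology.IsBounded Ω) (hm : MeasurableSet Ω) :
    ∃ T : Lp ℝ 2 (volume.restrict Ω) →L[ℝ] Lp ℝ 2 (volume.restrict Ω), IsCompactOperator T ∧
      ∀ u, T u =ᵐ[volume.restrict Ω] fun x => ∫ y in Ω, J (x - y) * u y := by
  have hfin : IsFiniteMeasure (volume.restrict Ω) :=
    ⟨by rw [Measure.restrict_apply_univ]; exact hΩ.measure_lt_top⟩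
  obtain ⟨R, hR, hΩR⟩ := hΩ.subset_closedBall_lt 0 0
  obtain ⟨ρ, hρ⟩ := exists_retraction_closedBall (N := N) hR
  set μ := volume.restrict Ω with hμ
  let k : 𝔼 → Lp ℝ 2 μ := fun x => BoundedContinuousFunction.toLp 2 μ ℝ (hJ.kernel x)
  have hk : Continuous k :=
    (BoundedContinuousFunction.toLp 2 μ ℝ).continuous.comp (hJ.continuous_kernel hN)
  let X := Metric.closedBall (0 : 𝔼) R
  have hX : CompactSpace X := isCompact_iff_compactSpace.1 (isCompact_closedBall _ _)
  let S : Lp ℝ 2 μ →ₗ[ℝ] (X →ᵇ ℝ) :=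
    { toFun := fun u => BoundedContinuousFunction.mkOfCompact
        ⟨fun x => ⟪k x, u⟫_ℝ, by fun_prop⟩
      map_add' := fun u v => by ext x; simp [inner_add_right]
      map_smul' := fun a u => by ext x; simp [inner_smul_right] }
  let Φ : (X →ᵇ ℝ) →ₗ[ℝ] Lp ℝ 2 μ :=
    (BoundedContinuousFunction.toLp 2 μ ℝ : (𝔼 →ᵇ ℝ) →L[ℝ] Lp ℝ 2 μ).toLinearMap ∘ₗ
    { toFun := fun w => w.compContinuous ρ
      map_add' := fun u v => rfl
      map_smul' := fun a u => rfl }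
  have hΦ : Continuous Φ := (BoundedContinuousFunction.toLp 2 μ ℝ).continuous.comp
    (BoundedContinuousFunction.continuous_compContinuous ρ)
  have hS : ∀ u (x : X), S u x = ⟪k x, u⟫_ℝ := fun _ _ => rfl
  have hcomp : IsCompactOperator (Φ ∘ₗ S) := by
    rw [isCompactOperator_iff_image_closedBall_subset_compact _ one_pos]
    obtain ⟨C, hC⟩ := (isCompact_closedBall (0 : 𝔼) R).exists_bound_of_continuousOn hk.continuousOn
    have hasc : IsCompact (closure (S '' Metric.closedBall 0 1)) := by
      refine BoundedContinuousFunction.arzela_ascoli (Metric.closedBall 0 C)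
        (isCompact_closedBall _ _) _ ?_ ?_
      · rintro _ x ⟨u, hu, rfl⟩
        rw [mem_closedBall_zero_iff] at hu ⊢
        rw [hS]
        refine (norm_inner_le_norm _ _).trans ?_
        have := hC x x.2
        nlinarith [norm_nonneg (k x), norm_nonneg u]
      · intro x
        rw [Metric.equicontinuousAt_iff_pair]
        intro ε hε
        have hcx : ContinuousAt (fun x : X => k x) x := (hk.comp continuous_subtype_val).continuousAt
        refine ⟨_, hcx (Metric.ball_mem_nhds _ (half_pos hε)), ?_⟩
        rintro y hy z hz ⟨_, u, hu, rfl⟩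
        rw [mem_closedBall_zero_iff] at hu
        change dist (S u y) (S u z) < ε
        rw [hS, hS, dist_eq_norm, ← inner_sub_left]
        refine (norm_inner_le_norm _ _).trans_lt ?_
        have h1 : ‖k y - k z‖ < ε := by
          rw [← dist_eq_norm]
          have := dist_triangle_right (k y) (k z) (k x)
          simp only [Set.mem_preimage, Metric.mem_ball] at hy hz
          linarith
        nlinarith [norm_nonneg (k y - k z), norm_nonneg u]
    refine ⟨_, hasc.image hΦ, ?_⟩
    rw [LinearMap.coe_comp, Set.image_comp]
    exact Set.image_mono subset_closure
  -- `S` and `Φ` are only linear maps; continuity of the composition is a consequence of its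
  -- compactness.
  refine ⟨ContinuousLinearMap.mkOfIsCompactOperator hcomp, hcomp, fun u => ?_⟩
  have h1 : (ContinuousLinearMap.mkOfIsCompactOperator hcomp) u =ᵐ[μ] (S u).compContinuous ρ :=
    BoundedContinuousFunction.coeFn_toLp 2 μ ℝ ((S u).compContinuous ρ)
  have h2 : ∀ᵐ x ∂μ, x ∈ Ω := ae_restrict_mem hm
  filter_upwards [h1, h2] with x hx hxΩ
  rw [hx, BoundedContinuousFunction.compContinuous_apply, hS,
    hρ x (mem_closedBall_zero_iff.1 (hΩR hxΩ)), L2.inner_def]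
  refine integral_congr_ae ?_
  filter_upwards [BoundedContinuousFunction.coeFn_toLp 2 μ ℝ (hJ.kernel x)] with y hy
  change u y * (k x : 𝔼 → ℝ) y = _
  rw [hy, mul_comm]; rfl

end ConvolutionOperator

/-! ### Extremal eigenvalues of compact symmetric operators. -/

section CompactSymmetric

open Module.End ContinuousLinearMap
open scoped InnerProductSpace

variable {H : Type*} [NormedAddCommGroup H] [InnerProductSpace ℝ H]
  {T : H →L[ℝ] H}

theorem ContinuousLinearMap.abs_inner_apply_self_le (T : H →L[ℝ] H) (w : H) :
    |⟪T w, w⟫_ℝ| ≤ ‖T‖ * ‖w‖ ^ 2 := by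
  refine (abs_real_inner_le_norm _ _).trans ?_
  nlinarith [T.le_opNorm w, norm_nonneg w]

theorem LinearMap.IsSymmetric.opNorm_le_of_abs_inner_le (hT : T.IsSymmetric) {κ : ℝ}
    (hκ : 0 ≤ κ) (h : ∀ w, |⟪T w, w⟫_ℝ| ≤ κ * ‖w‖ ^ 2) : ‖T‖ ≤ κ := by
  rw [norm_eq_iSup_rayleighQuotient T hT]
  refine ciSup_le fun w => ?_
  rw [rayleighQuotient, reApplyInnerSelf_apply, abs_div, abs_sq]
  exact div_le_of_le_mul₀ (sq_nonneg _) hκ (h w)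

/-- For compact `T`, a nonzero number is an eigenvalue or lies in the resolvent set. If both `‖T‖`
and `-‖T‖` lay in the resolvent set, the Rayleigh quotients would stay away from `±‖T‖`, although
the supremum of their moduli is `‖T‖`. -/
theorem IsCompactOperator.exists_eigenvector_abs_eq_norm [CompleteSpace H] [Nontrivial H]
    (hc : IsCompactOperator T)
    (hT : T.IsSymmetric) : ∃ (μ : ℝ) (v : H), v ≠ 0 ∧ T v = μ • v ∧ |μ| = ‖T‖ := by
  by_cases h0 : T = 0
  · obtain ⟨v, hv⟩ := exists_ne (0 : H)
    exact ⟨0, v, hv, by simp [h0], by simp [h0]⟩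
  have hpos : 0 < ‖T‖ := norm_pos_iff.2 h0
  suffices h : HasEigenvalue (T : Module.End ℝ H) ‖T‖ ∨ HasEigenvalue (T : Module.End ℝ H) (-‖T‖) by
    rcases h with h | h <;> obtain ⟨v, hv⟩ := h.exists_hasEigenvector
    · exact ⟨_, v, hv.2, hv.apply_eq_smul, abs_norm T⟩
    · exact ⟨_, v, hv.2, hv.apply_eq_smul, by rw [abs_neg, abs_norm]⟩
  by_contra! h
  have h1 : ‖T‖ ∈ resolventSet ℝ T :=
    (hc.hasEigenvalue_or_mem_resolventSet hpos.ne').resolve_left h.1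
  have h2 : -‖T‖ ∈ resolventSet ℝ T :=
    (hc.hasEigenvalue_or_mem_resolventSet (neg_ne_zero.2 hpos.ne')).resolve_left h.2
  obtain ⟨c, hc0, hc⟩ := T.abs_rayleighQuotient_le_of_norm_mem_resolventSet h1 h2
  have := ciSup_le hc
  rw [← norm_eq_iSup_rayleighQuotient T hT] at this
  linarith

/-- Either `‖T‖ < κ` and the gap is `κ - ‖T‖`, or `‖T‖ = κ` and then `κ` is in the resolvent set of
`-T`, which pushes the Rayleigh quotient of `-T` strictly below its norm. -/
theorem IsCompactOperator.exists_neg_le_inner [CompleteSpace H] (hc : IsCompactOperator T) (hT : T.IsSymmetric)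
    {κ : ℝ} (hκ : 0 < κ) (h : ∀ w, |⟪T w, w⟫_ℝ| ≤ κ * ‖w‖ ^ 2)
    (hne : ∀ v, T v = (-κ) • v → v = 0) :
    ∃ δ > 0, ∀ w, -(κ - δ) * ‖w‖ ^ 2 ≤ ⟪T w, w⟫_ℝ := by
  rcases (hT.opNorm_le_of_abs_inner_le hκ.le h).lt_or_eq with hlt | heq
  · refine ⟨κ - ‖T‖, sub_pos.2 hlt, fun w => ?_⟩
    have := neg_le_of_abs_le (T.abs_inner_apply_self_le w)
    linarith
  rcases subsingleton_or_nontrivial H with hs | hn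
  · exact ⟨1, one_pos, fun w => by simp [Subsingleton.elim w 0]⟩
  have h1 : ‖-T‖ ∈ resolventSet ℝ (-T) := by
    rw [norm_neg, heq]
    refine (hc.neg.hasEigenvalue_or_mem_resolventSet (T := -T) hκ.ne').resolve_left fun he => ?_
    obtain ⟨v, hv⟩ := he.exists_hasEigenvector
    have := hv.apply_eq_smul
    refine hv.2 (hne v ?_)
    rw [neg_smul, ← this]
    simp
  obtain ⟨δ, hδ, hle⟩ := (-T).rayleighQuotient_le_of_norm_mem_resolventSet h1
  refine ⟨δ, hδ, fun w => ?_⟩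
  by_cases hw : w = 0
  · simp [hw]
  have hw' : 0 < ‖w‖ ^ 2 := by positivity
  have := hle w
  rw [rayleighQuotient, reApplyInnerSelf_apply, norm_neg, heq, div_le_iff₀ hw'] at this
  simp at this
  linarith

end CompactSymmetric

/-! ### Transfer of the spectral theory to functions supported in `Ω`. -/

section SpectralTheory

open scoped InnerProductSpace

variable {N : ℕ}

local notation "𝔼" => EuclideanSpace ℝ (Fin N)

variable {J f g h : EuclideanSpace ℝ (Fin N) → ℝ} {Ω : Set (EuclideanSpace ℝ (Fin N))}

namespace SupportedL2

/-- The class in `L²(Ω)` of a square-integrable function vanishing outside `Ω`. -/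
noncomputable def toLp (hf : SupportedL2 Ω f) : Lp ℝ 2 (volume.restrict Ω) :=
  (hf.memLp.restrict Ω).toLp f

theorem coeFn_toLp (hf : SupportedL2 Ω f) : hf.toLp =ᵐ[volume.restrict Ω] f :=
  (hf.memLp.restrict Ω).coeFn_toLp

theorem setIntegral_mul (hf : SupportedL2 Ω f) (g : 𝔼 → ℝ) :
    ∫ x in Ω, f x * g x = ∫ x, f x * g x :=
  setIntegral_eq_integral_of_forall_compl_eq_zero fun x hx => by
    rw [hf.eq_zero_of_notMem x hx, zero_mul]

theorem inner_toLp (hf : SupportedL2 Ω f) (hg : SupportedL2 Ω g) :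
    ⟪hf.toLp, hg.toLp⟫_ℝ = ∫ x, f x * g x := by
  rw [L2.inner_def, ← hf.setIntegral_mul]
  refine integral_congr_ae ?_
  filter_upwards [hf.coeFn_toLp, hg.coeFn_toLp] with x h1 h2
  rw [h1, h2]
  simp [mul_comm]

theorem norm_toLp_sq (hf : SupportedL2 Ω f) : ‖hf.toLp‖ ^ 2 = ∫ x, f x * f x := by
  rw [← real_inner_self_eq_norm_sq, hf.inner_toLp hf]

theorem toLp_eq_zero (hf : SupportedL2 Ω f) : hf.toLp = 0 ↔ f =ᵐ[volume] 0 := by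
  constructor
  · intro h0
    by_contra h
    have := hf.integral_mul_self_pos h
    rw [← hf.norm_toLp_sq, h0] at this
    simp at this
  · intro h0
    rw [← norm_eq_zero, ← sq_eq_zero_iff, hf.norm_toLp_sq, integral_eq_zero_of_ae]
    filter_upwards [h0] with x hx
    simp [hx]

theorem exists_toLp_eq (hm : MeasurableSet Ω) (u : Lp ℝ 2 (volume.restrict Ω)) :
    ∃ (f : 𝔼 → ℝ) (hf : SupportedL2 Ω f), hf.toLp = u := by
  have hf : SupportedL2 Ω (Ω.indicator u) :=
    ⟨(memLp_indicator_iff_restrict hm).2 (Lp.memLp u), fun x hx => Set.indicator_of_notMem hx _⟩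
  refine ⟨_, hf, Lp.ext ?_⟩
  filter_upwards [hf.coeFn_toLp, ae_restrict_mem hm] with x h1 h2
  rw [h1, Set.indicator_of_mem h2]

theorem integral_kernel_toLp (hf : SupportedL2 Ω f) (x : 𝔼) :
    ∫ y in Ω, J (x - y) * hf.toLp y = ∫ y, J (x - y) * f y := by
  have : ∫ y in Ω, J (x - y) * f y = ∫ y, J (x - y) * f y :=
    setIntegral_eq_integral_of_forall_compl_eq_zero fun y hy => by
      rw [hf.eq_zero_of_notMem y hy, mul_zero]
  rw [← this]
  refine integral_congr_ae ?_
  filter_upwards [hf.coeFn_toLp] with y hy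
  rw [hy]

end SupportedL2

/-- The operator `u ↦ (J * u)|_Ω` on `L²(Ω)`, with its quadratic form and its eigenvectors. -/
theorem exists_symmetric_convolution_operator (hJ : HypothesisH J) (hN : 1 ≤ N)
    (hΩ : Bornology.IsBounded Ω) (hm : MeasurableSet Ω) :
    ∃ T : Lp ℝ 2 (volume.restrict Ω) →L[ℝ] Lp ℝ 2 (volume.restrict Ω), IsCompactOperator T ∧
      T.IsSymmetric ∧
      (∀ {f g} (hf : SupportedL2 Ω f) (hg : SupportedL2 Ω g),
        ⟪T hf.toLp, hg.toLp⟫_ℝ = kernelForm J f g) ∧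
      ∀ {f} (hf : SupportedL2 Ω f) (μ : ℝ), T hf.toLp = μ • hf.toLp ↔
        ∀ᵐ x ∂volume.restrict Ω, ∫ y, J (x - y) * f y = μ * f x := by
  obtain ⟨T, hc, hT⟩ := exists_convolution_operator hJ hN hΩ hm
  have hTf : ∀ {f} (hf : SupportedL2 Ω f),
      T hf.toLp =ᵐ[volume.restrict Ω] fun x => ∫ y, J (x - y) * f y := fun hf => by
    filter_upwards [hT hf.toLp] with x hx
    rw [hx, hf.integral_kernel_toLp]
  have hform : ∀ {f g} (hf : SupportedL2 Ω f) (hg : SupportedL2 Ω g),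
      ⟪T hf.toLp, hg.toLp⟫_ℝ = kernelForm J f g := fun {f g} hf hg => by
    rw [kernelForm_comm hJ, kernelForm_eq_integral hJ (hg.integrable hΩ) (hf.integrable hΩ),
      ← hg.setIntegral_mul, L2.inner_def]
    refine integral_congr_ae ?_
    filter_upwards [hTf hf, hg.coeFn_toLp] with x h1 h2
    rw [h1, h2]
    simp
  refine ⟨T, hc, fun u v => ?_, hform, fun {f} hf μ => ?_⟩
  · obtain ⟨f, hf, rfl⟩ := SupportedL2.exists_toLp_eq hm u
    obtain ⟨g, hg, rfl⟩ := SupportedL2.exists_toLp_eq hm v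
    rw [ContinuousLinearMap.coe_coe, hform, real_inner_comm, hform, kernelForm_comm hJ]
  · constructor
    · intro h
      have h3 := Lp.coeFn_smul μ hf.toLp
      rw [← h] at h3
      filter_upwards [hTf hf, hf.coeFn_toLp, h3] with x h1 h2 h3
      rw [← h1, h3, Pi.smul_apply, h2, smul_eq_mul]
    · intro h
      refine Lp.ext ?_
      filter_upwards [hTf hf, hf.coeFn_toLp, Lp.coeFn_smul μ hf.toLp, h] with x h1 h2 h3 h4
      rw [h1, h3, Pi.smul_apply, h2, smul_eq_mul, h4]

theorem isEigenfunction_iff (hf : SupportedL2 Ω f) {lam : ℝ} :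
    IsEigenfunction J Ω f lam ↔ ¬ f =ᵐ[volume] 0 ∧
      ∀ᵐ x ∂volume.restrict Ω, ∫ y, J (x - y) * f y = (1 - lam) * f x := by
  constructor
  · intro h
    refine ⟨h.ne_zero, ?_⟩
    filter_upwards [h.equation] with x hx
    linarith
  · rintro ⟨h0, h⟩
    refine ⟨hf.memLp, hf.eq_zero_of_notMem, h0, ?_⟩
    filter_upwards [h] with x hx
    linarith

/-- On the orthogonal complement of a set of eigenfunctions, the quadratic form is dominated by the
modulus of an eigenvalue attained there. -/
theorem exists_isEigenfunction_abs_kernelForm_le (hJ : HypothesisH J) (hN : 1 ≤ N)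
    (hΩ : Bornology.IsBounded Ω) (hm : MeasurableSet Ω) {U : Set (𝔼 → ℝ)}
    (hU : ∀ u ∈ U, ∃ lam, IsEigenfunction J Ω u lam)
    (hf : SupportedL2 Ω f) (hf0 : ¬ f =ᵐ[volume] 0) (hfU : ∀ u ∈ U, ∫ x, u x * f x = 0) :
    ∃ v lam, IsEigenfunction J Ω v lam ∧ (∀ u ∈ U, ∫ x, u x * v x = 0) ∧
      ∀ g, SupportedL2 Ω g → (∀ u ∈ U, ∫ x, u x * g x = 0) →
        |kernelForm J g g| ≤ |1 - lam| * ∫ x, g x * g x := by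
  obtain ⟨T, hc, hsym, hform, heig⟩ := exists_symmetric_convolution_operator hJ hN hΩ hm
  let V : Submodule ℝ (Lp ℝ 2 (volume.restrict Ω)) :=
    Submodule.span ℝ {w | ∃ u, ∃ hu : SupportedL2 Ω u, u ∈ U ∧ hu.toLp = w}
  have hmem : ∀ {g} (hg : SupportedL2 Ω g), hg.toLp ∈ Vᗮ ↔ ∀ u ∈ U, ∫ x, u x * g x = 0 := by
    intro g hg
    constructor
    · intro h u hu
      obtain ⟨lam, hlam⟩ := hU u hu
      rw [← hlam.supportedL2.inner_toLp hg]
      exact h _ (Submodule.subset_span ⟨u, hlam.supportedL2, hu, rfl⟩)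
    · intro h
      rw [Submodule.mem_orthogonal]
      intro w hw
      refine Submodule.span_induction ?_ (by simp) ?_ ?_ hw
      · rintro _ ⟨u, hu, huU, rfl⟩
        rw [hu.inner_toLp hg, h u huU]
      · intro a b _ _ ha hb
        rw [inner_add_left, ha, hb, add_zero]
      · intro c a _ ha
        rw [inner_smul_left, ha, mul_zero]
  -- `V` is spanned by eigenvectors of a symmetric operator, so its orthogonal complement is
  -- invariant and the extremal eigenvector can be sought for the restriction.
  have hinv : ∀ w ∈ Vᗮ, T w ∈ Vᗮ := by
    intro w hw
    obtain ⟨g, hg, rfl⟩ := SupportedL2.exists_toLp_eq hm w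
    obtain ⟨g', hg', h'⟩ := SupportedL2.exists_toLp_eq hm (T hg.toLp)
    rw [← h', hmem]
    intro u hu
    obtain ⟨lam, hlam⟩ := hU u hu
    rw [← hlam.supportedL2.inner_toLp hg', h']
    have h2 := (heig hlam.supportedL2 (1 - lam)).2 ((isEigenfunction_iff hlam.supportedL2).1 hlam).2
    have h3 := hsym hlam.supportedL2.toLp hg.toLp
    rw [ContinuousLinearMap.coe_coe, h2] at h3
    rw [← h3, inner_smul_left, hlam.supportedL2.inner_toLp hg, (hmem hg).1 hw u hu, mul_zero]
  let S : Vᗮ →L[ℝ] Vᗮ := T.restrict hinv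
  have hSc : IsCompactOperator S := hc.restrict' hinv
  have hSs : S.IsSymmetric := hsym.restrict_invariant hinv
  have hne : Nontrivial Vᗮ :=
    ⟨⟨⟨hf.toLp, (hmem hf).2 hfU⟩, 0, fun h => hf0 (hf.toLp_eq_zero.1 (congrArg Subtype.val h))⟩⟩
  obtain ⟨μ, ⟨v, hvV⟩, hv0, hv, hμ⟩ := hSc.exists_eigenvector_abs_eq_norm hSs
  obtain ⟨g, hg, rfl⟩ := SupportedL2.exists_toLp_eq hm v
  have hv' : T hg.toLp = μ • hg.toLp := congrArg Subtype.val hv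
  refine ⟨g, 1 - μ, (isEigenfunction_iff hg).2 ⟨fun h => hv0 ?_, ?_⟩, (hmem hg).1 hvV, ?_⟩
  · exact Subtype.ext (hg.toLp_eq_zero.2 h)
  · rw [sub_sub_cancel]; exact (heig hg μ).1 hv'
  · intro k hk hkU
    rw [sub_sub_cancel, hμ, ← hk.norm_toLp_sq, ← hform hk hk]
    exact S.abs_inner_apply_self_le ⟨hk.toLp, (hmem hk).2 hkU⟩

theorem exists_neg_le_kernelForm (hJ : HypothesisH J) (hN : 1 ≤ N)
    (hΩ : Bornology.IsBounded Ω) (hm : MeasurableSet Ω) {κ : ℝ} (hκ : 0 < κ)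
    (h : ∀ f, SupportedL2 Ω f → |kernelForm J f f| ≤ κ * ∫ x, f x * f x)
    (hne : ∀ u lam, IsEigenfunction J Ω u lam → 1 - lam ≠ -κ) :
    ∃ δ > 0, ∀ f, SupportedL2 Ω f → -(κ - δ) * (∫ x, f x * f x) ≤ kernelForm J f f := by
  obtain ⟨T, hc, hsym, hform, heig⟩ := exists_symmetric_convolution_operator hJ hN hΩ hm
  obtain ⟨δ, hδ, hle⟩ := hc.exists_neg_le_inner hsym hκ
    (fun w => by
      obtain ⟨f, hf, rfl⟩ := SupportedL2.exists_toLp_eq hm w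
      rw [hform hf hf, hf.norm_toLp_sq]
      exact h f hf)
    (fun w hw => by
      obtain ⟨f, hf, rfl⟩ := SupportedL2.exists_toLp_eq hm w
      by_contra h0
      refine hne f (1 + κ) ((isEigenfunction_iff hf).2
        ⟨fun h1 => h0 (hf.toLp_eq_zero.2 h1), ?_⟩) (by ring)
      have := (heig hf (-κ)).1 hw
      rwa [show 1 - (1 + κ) = -κ by ring])
  refine ⟨δ, hδ, fun f hf => ?_⟩
  rw [← hform hf hf, ← hf.norm_toLp_sq]
  exact hle _

end SpectralTheory

/-! ### Positivity of the form and consequences for eigenfunctions. -/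

section Positivity

variable {N : ℕ}

local notation "𝔼" => EuclideanSpace ℝ (Fin N)

variable {J f g u : EuclideanSpace ℝ (Fin N) → ℝ} {Ω : Set (EuclideanSpace ℝ (Fin N))} {lam : ℝ}

/-- Near the origin `J ≥ J 0 / 2`, so a small ball carrying some mass of `f` already contributes at
least `J 0 / 2` times the square of that mass. -/
theorem kernelForm_self_pos (hJ : HypothesisH J) (hf : Integrable f) (hf0 : ∀ x, 0 ≤ f x)
    (hne : ¬ f =ᵐ[volume] 0) : 0 < kernelForm J f f := by
  obtain ⟨η, hη, hJη⟩ : ∃ η > 0, ∀ z : 𝔼, ‖z‖ < η → J 0 / 2 ≤ J z := by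
    have := hJ.continuous.continuousAt (x := 0) |>.eventually
      (eventually_ge_nhds (half_lt_self hJ.pos_zero))
    obtain ⟨η, hη, h⟩ := Metric.eventually_nhds_iff.1 this
    exact ⟨η, hη, fun z hz => h (by simpa using hz)⟩
  have hs : volume {x | f x ≠ 0} ≠ 0 := fun h => hne (by
    rw [Filter.EventuallyEq, ae_iff]; exact h)
  obtain ⟨x₀, -, hx₀⟩ := exists_mem_forall_mem_nhdsWithin_pos_measure hs
  -- Radius `η / 2` makes any two points of `B` closer than `η`.
  set B := Metric.ball x₀ (η / 2)
  set b := B.indicator f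
  have hb : Integrable b := hf.indicator Metric.isOpen_ball.measurableSet
  have hb0 : ∀ x, 0 ≤ b x := fun x => Set.indicator_nonneg (fun x _ => hf0 x) x
  have hbpos : 0 < ∫ x, b x := by
    rw [integral_pos_iff_support_of_nonneg hb0 hb]
    have := hx₀ (B ∩ {x | f x ≠ 0}) (Filter.inter_mem
      (mem_nhdsWithin_of_mem_nhds (Metric.ball_mem_nhds _ (half_pos hη))) self_mem_nhdsWithin)
    rwa [Set.support_indicator]
  have h1 : kernelForm J b b ≤ kernelForm J f f :=
    kernelForm_mono hJ hb hb hf hf hb0 hb0 (Set.indicator_le_self' fun x _ => hf0 x)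
      (Set.indicator_le_self' fun x _ => hf0 x)
  have h2 : J 0 / 2 * ((∫ x, b x) * ∫ x, b x) ≤ kernelForm J b b := by
    rw [← integral_prod_mul, ← integral_const_mul]
    refine integral_mono ((hb.mul_prod hb).const_mul _) (hJ.integrable_kernel hb hb) fun p => ?_
    by_cases hp : p.1 ∈ B ∧ p.2 ∈ B
    · have : J 0 / 2 ≤ J (p.1 - p.2) := hJη _ (by
        rw [← dist_eq_norm]
        have := dist_triangle_right p.1 p.2 x₀
        have h1 := Metric.mem_ball.1 hp.1
        have h2 := Metric.mem_ball.1 hp.2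
        linarith)
      simp only
      nlinarith [mul_nonneg (hb0 p.1) (hb0 p.2)]
    · have : b p.1 = 0 ∨ b p.2 = 0 := by
        by_contra! h
        exact hp ⟨Set.mem_of_indicator_ne_zero h.1, Set.mem_of_indicator_ne_zero h.2⟩
      rcases this with h | h <;> simp [h]
  have := hJ.pos_zero
  have : 0 < J 0 / 2 * ((∫ x, b x) * ∫ x, b x) := by positivity
  linarith

theorem eq_sub_max_neg (a : ℝ) : a = 1 * max a 0 + -1 * max (-a) 0 := by
  rcases le_total 0 a with h | h
  · rw [max_eq_left h, max_eq_right (by linarith)]; ring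
  · rw [max_eq_right h, max_eq_left (by linarith)]; ring

theorem abs_eq_max_add_max_neg (a : ℝ) : |a| = 1 * max a 0 + 1 * max (-a) 0 := by
  rcases le_total 0 a with h | h
  · rw [max_eq_left h, max_eq_right (by linarith), abs_of_nonneg h]; ring
  · rw [max_eq_right h, max_eq_left (by linarith), abs_of_nonpos h]; ring

/-- With `u = u⁺ - u⁻` the mixed terms cancel and `Q(|u|) + Q(u) = 2 (Q(u⁺) + Q(u⁻)) > 0`.
Consequently a negative eigenvalue never has the largest modulus. -/
theorem SupportedL2.neg_kernelForm_lt_kernelForm_abs (hJ : HypothesisH J) (hu : SupportedL2 Ω u)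
    (hΩ : Bornology.IsBounded Ω) (h0 : ¬ u =ᵐ[volume] 0) :
    -kernelForm J u u < kernelForm J (fun x => |u x|) (fun x => |u x|) := by
  have hp := hu.max_zero.integrable hΩ
  have hm := hu.max_neg_zero.integrable hΩ
  have h1 : kernelForm J u u = _ := kernelForm_lin_comb_self hJ hp hm 1 (-1)
    |>.symm ▸ kernelForm_congr_ae (.of_forall fun x => eq_sub_max_neg (u x))
      (.of_forall fun x => eq_sub_max_neg (u x))
  have h2 : kernelForm J (fun x => |u x|) (fun x => |u x|) = _ :=
    kernelForm_lin_comb_self hJ hp hm 1 1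
    |>.symm ▸ kernelForm_congr_ae (.of_forall fun x => abs_eq_max_add_max_neg (u x))
      (.of_forall fun x => abs_eq_max_add_max_neg (u x))
  have hp0 : ∀ x, 0 ≤ max (u x) 0 := fun _ => le_max_right _ _
  have hm0 : ∀ x, 0 ≤ max (-u x) 0 := fun _ => le_max_right _ _
  have hpn := kernelForm_nonneg hJ hp0 hp0
  have hmn := kernelForm_nonneg hJ hm0 hm0
  have hpos : 0 < kernelForm J (fun x => max (u x) 0) (fun x => max (u x) 0) +
      kernelForm J (fun x => max (-u x) 0) (fun x => max (-u x) 0) := by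
    by_cases hz : (fun x => max (u x) 0) =ᵐ[volume] 0
    · have : ¬ (fun x => max (-u x) 0) =ᵐ[volume] 0 := fun hz' => h0 (by
        filter_upwards [hz, hz'] with x h1 h2
        rw [eq_sub_max_neg (u x)]
        simp only [Pi.zero_apply] at h1 h2
        simp [h1, h2])
      linarith [kernelForm_self_pos hJ hm hm0 this]
    · linarith [kernelForm_self_pos hJ hp hp0 hz]
  rw [h1, h2]
  linarith

namespace IsEigenfunction

theorem kernelForm_eq (hJ : HypothesisH J) (hΩ : Bornology.IsBounded Ω)
    (hu : IsEigenfunction J Ω u lam) (hg : SupportedL2 Ω g) :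
    kernelForm J u g = (1 - lam) * ∫ x, u x * g x := by
  rw [kernelForm_comm hJ, kernelForm_eq_integral hJ (hg.integrable hΩ)
    (hu.supportedL2.integrable hΩ), ← hg.setIntegral_mul, ← hu.supportedL2.setIntegral_mul,
    ← integral_const_mul]
  refine integral_congr_ae ?_
  filter_upwards [((isEigenfunction_iff hu.supportedL2).1 hu).2] with x hx
  rw [hx]; ring

theorem integral_mul_eq_zero (hJ : HypothesisH J) (hΩ : Bornology.IsBounded Ω)
    {v : 𝔼 → ℝ} {lam' : ℝ} (hu : IsEigenfunction J Ω u lam)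
    (hv : IsEigenfunction J Ω v lam') (hne : lam ≠ lam') : ∫ x, u x * v x = 0 := by
  have h1 := hu.kernelForm_eq hJ hΩ hv.supportedL2
  have h2 := hv.kernelForm_eq hJ hΩ hu.supportedL2
  rw [kernelForm_comm hJ, h1] at h2
  simp only [mul_comm (v _)] at h2
  have : (lam' - lam) * ∫ x, u x * v x = 0 := by linarith
  exact (mul_eq_zero.1 this).resolve_left (sub_ne_zero.2 hne.symm)

theorem neg (hu : IsEigenfunction J Ω u lam) : IsEigenfunction J Ω (fun x => -u x) lam := by
  have hs : SupportedL2 Ω fun x => -u x := by simpa using hu.supportedL2.const_mul (-1)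
  refine (isEigenfunction_iff hs).2 ⟨fun h => hu.ne_zero ?_, ?_⟩
  · filter_upwards [h] with x hx
    simpa using hx
  · filter_upwards [((isEigenfunction_iff hu.supportedL2).1 hu).2] with x hx
    simp only [mul_neg, integral_neg, hx]

/-- Test the eigenvalue equation with `u⁺`: the mixed term between `u⁻` and `u⁺` enters with a minus
sign and is nonnegative before it, so it can be dropped. -/
theorem le_kernelForm_max_zero (hJ : HypothesisH J) (hΩ : Bornology.IsBounded Ω)
    (hu : IsEigenfunction J Ω u lam) :
    (1 - lam) * (∫ x, max (u x) 0 * max (u x) 0) ≤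
      kernelForm J (fun x => max (u x) 0) (fun x => max (u x) 0) := by
  have hp := hu.supportedL2.max_zero
  have hq := hu.supportedL2.max_neg_zero
  have h1 := hu.kernelForm_eq hJ hΩ hp
  have h2 : ∫ x, u x * max (u x) 0 = ∫ x, max (u x) 0 * max (u x) 0 := by
    refine integral_congr_ae (.of_forall fun x => ?_)
    rcases le_total 0 (u x) with h | h <;> simp [h]
  have h3 : kernelForm J u (fun x => max (u x) 0) =
      1 * kernelForm J (fun x => max (u x) 0) (fun x => max (u x) 0) +
        -1 * kernelForm J (fun x => max (-u x) 0) (fun x => max (u x) 0) := by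
    rw [← kernelForm_smul_left, ← kernelForm_smul_left, ← kernelForm_add_left hJ
      ((hp.const_mul 1).integrable hΩ) ((hq.const_mul (-1)).integrable hΩ) (hp.integrable hΩ)]
    exact kernelForm_congr_ae (.of_forall fun x => eq_sub_max_neg (u x)) (ae_eq_refl _)
  have h4 : 0 ≤ kernelForm J (fun x => max (-u x) 0) (fun x => max (u x) 0) :=
    kernelForm_nonneg hJ (fun _ => le_max_right _ _) fun _ => le_max_right _ _
  rw [h2] at h1
  linarith

/-- Eigenfunctions for `lam ≠ 1` agree almost everywhere on `Ω` with continuous functions. -/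
theorem exists_continuous (hJ : HypothesisH J) (hΩ : Bornology.IsBounded Ω)
    (hu : IsEigenfunction J Ω u lam) (hlam : 1 - lam ≠ 0) :
    ∃ w : 𝔼 → ℝ, Continuous w ∧ (∃ C, ∀ x, |w x| ≤ C) ∧ ∀ᵐ x ∂volume.restrict Ω, u x = w x := by
  have hi := hu.supportedL2.integrable hΩ
  have hb : ∀ x y, ‖J (x - y) * u y‖ ≤ J 0 * ‖u y‖ := fun x y => by
    rw [norm_mul]
    exact mul_le_mul_of_nonneg_right (hJ.norm_le _) (norm_nonneg _)
  refine ⟨fun x => (1 - lam)⁻¹ * ∫ y, J (x - y) * u y, ?_,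
    ⟨|(1 - lam)⁻¹| * ∫ y, J 0 * ‖u y‖, fun x => ?_⟩, ?_⟩
  · refine continuous_const.mul (continuous_of_dominated (bound := fun y => J 0 * ‖u y‖) ?_ ?_ ?_ ?_)
    · intro x
      exact (hJ.continuous.comp (continuous_const.sub continuous_id)).aestronglyMeasurable.mul
        hi.aestronglyMeasurable
    · exact fun x => .of_forall fun y => hb x y
    · exact hi.norm.const_mul _
    · exact .of_forall fun y =>
        (hJ.continuous.comp (continuous_id.sub continuous_const)).mul continuous_const
  · rw [abs_mul]
    exact mul_le_mul_of_nonneg_left (norm_integral_le_of_norm_le (hi.norm.const_mul _)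
      (.of_forall fun y => hb x y)) (abs_nonneg _)
  · filter_upwards [((isEigenfunction_iff hu.supportedL2).1 hu).2] with x hx
    rw [hx, inv_mul_cancel_left₀ hlam]

end IsEigenfunction

end Positivity

/-! ### Reflections in hyperplanes and two-point rearrangement. -/

section Polarization

open scoped InnerProductSpace

/-- Reflection in a hyperplane not containing the origin; `s` is an affine functional vanishing on
the hyperplane and negative at the origin, normalized to be twice the signed distance. -/
structure HyperplaneReflection (N : ℕ) where
  σ : EuclideanSpace ℝ (Fin N) → EuclideanSpace ℝ (Fin N)
  s : EuclideanSpace ℝ (Fin N) → ℝ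
  involutive : Function.Involutive σ
  measurePreserving : MeasurePreserving σ
  s_map : ∀ x, s (σ x) = -s x
  norm_sub_sq : ∀ x y, ‖x - σ y‖ ^ 2 = ‖x - y‖ ^ 2 + s x * s y
  s_zero : s 0 < 0

variable {N : ℕ}

local notation "𝔼" => EuclideanSpace ℝ (Fin N)

/-- The hyperplane is the perpendicular bisector of `p` and `q`; since `p` is nearer to the origin,
both lie on the same side. -/
theorem exists_hyperplaneReflection {p q : 𝔼} (hpq : ‖p‖ < ‖q‖) :
    ∃ P : HyperplaneReflection N, P.σ p = q ∧ P.s p < 0 := by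
  have hne : q - p ≠ 0 := fun h => by rw [sub_eq_zero.1 h] at hpq; exact lt_irrefl _ hpq
  have hpos : 0 < ‖q - p‖ := norm_pos_iff.2 hne
  set n : 𝔼 := ‖q - p‖⁻¹ • (q - p) with hn
  have hn1 : ‖n‖ = 1 := by rw [hn, norm_smul, norm_inv, norm_norm, inv_mul_cancel₀ hpos.ne']
  have hnn : ⟪n, n⟫_ℝ = 1 := by rw [real_inner_self_eq_norm_sq, hn1, one_pow]
  set m : 𝔼 := (2⁻¹ : ℝ) • (p + q) with hm
  let s : 𝔼 → ℝ := fun x => 2 * ⟪x - m, n⟫_ℝ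
  let σ : 𝔼 → 𝔼 := fun x => x - s x • n
  have hmap : ∀ x, s (σ x) = -s x := fun x => by
    simp only [s, σ, sub_right_comm x _ m, inner_sub_left (x - m), inner_smul_left, hnn]
    simp; ring
  have hσ : σ = (fun x => x + m) ∘ (Submodule.reflection (ℝ ∙ n)ᗮ) ∘ fun x => x + -m := by
    funext x
    simp only [σ, s, Function.comp, Submodule.reflection_orthogonal_apply,
      Submodule.reflection_singleton_apply, hn1, ← sub_eq_add_neg]
    rw [real_inner_comm, two_smul, two_mul]
    simp [add_smul]
    abel
  have hsub : ∀ x y, ‖x - σ y‖ ^ 2 = ‖x - y‖ ^ 2 + s x * s y := fun x y => by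
    have h1 : x - σ y = (x - y) + s y • n := by simp only [σ]; abel
    have h2 : 2 * ⟪x - y, n⟫_ℝ = s x - s y := by
      simp only [s]
      rw [← mul_sub, ← inner_sub_left, sub_sub_sub_cancel_right]
    rw [h1, norm_add_sq_real, inner_smul_right, norm_smul, hn1, mul_one, Real.norm_eq_abs, sq_abs]
    linear_combination s y * h2
  refine ⟨⟨σ, s, fun x => ?_, ?_, hmap, hsub, ?_⟩, ?_, ?_⟩
  · have := hmap x
    change σ x - s (σ x) • n = x
    rw [this]; simp [σ]
  · rw [hσ]
    exact (measurePreserving_add_right volume m).comp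
      ((LinearIsometryEquiv.measurePreserving _).comp (measurePreserving_add_right volume (-m)))
  · have : ⟪p + q, q - p⟫_ℝ = ‖q‖ ^ 2 - ‖p‖ ^ 2 := by
      rw [inner_sub_right, inner_add_left, inner_add_left, real_inner_comm p q,
        real_inner_self_eq_norm_sq, real_inner_self_eq_norm_sq]
      ring
    have h2 : s 0 = -(‖q - p‖⁻¹ * (‖q‖ ^ 2 - ‖p‖ ^ 2)) := by
      simp only [s, zero_sub, inner_neg_left, hm, hn, inner_smul_left, inner_smul_right, this]
      simp
      ring
    have h3 : 0 < ‖q‖ ^ 2 - ‖p‖ ^ 2 := by nlinarith [norm_nonneg p]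
    rw [h2]
    exact neg_lt_zero.2 (mul_pos (inv_pos.2 hpos) h3)
  all_goals
    have hsp : s p = -‖q - p‖ := by
      have : p - m = (-2⁻¹ : ℝ) • (q - p) := by rw [hm]; module
      simp only [s, this, hn, inner_smul_left, inner_smul_right, real_inner_self_eq_norm_sq]
      field_simp
      simp
  · change p - s p • n = q
    rw [hsp, hn, neg_smul, smul_inv_smul₀ hpos.ne']
    abel
  · change s p < 0
    rw [hsp]; exact neg_lt_zero.2 hpos

namespace HyperplaneReflection

variable (P : HyperplaneReflection N) {J f g : EuclideanSpace ℝ (Fin N) → ℝ}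

theorem norm_map_sub_map (x y : 𝔼) : ‖P.σ x - P.σ y‖ = ‖x - y‖ := by
  rw [← sq_eq_sq₀ (norm_nonneg _) (norm_nonneg _), P.norm_sub_sq, norm_sub_rev, P.norm_sub_sq,
    P.s_map, norm_sub_rev]
  ring

theorem norm_map_sub (x y : 𝔼) : ‖P.σ x - y‖ = ‖x - P.σ y‖ := by
  rw [← P.norm_map_sub_map x, P.involutive]

theorem continuous_map : Continuous P.σ :=
  (Isometry.of_dist_eq fun x y => by
    rw [dist_eq_norm, dist_eq_norm, P.norm_map_sub_map]).continuous

theorem norm_sub_le {x y : 𝔼} (h : 0 ≤ P.s x * P.s y) : ‖x - y‖ ≤ ‖x - P.σ y‖ := by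
  rw [← sq_le_sq₀ (norm_nonneg _) (norm_nonneg _), P.norm_sub_sq]
  linarith

theorem norm_sub_map_le {x y : 𝔼} (h : P.s x * P.s y ≤ 0) : ‖x - P.σ y‖ ≤ ‖x - y‖ := by
  rw [← sq_le_sq₀ (norm_nonneg _) (norm_nonneg _), P.norm_sub_sq]
  linarith

theorem norm_le_norm_map {x : 𝔼} (h : P.s x ≤ 0) : ‖x‖ ≤ ‖P.σ x‖ := by
  simpa using P.norm_sub_le (x := 0) (mul_nonneg_of_nonpos_of_nonpos P.s_zero.le h)

theorem norm_map_le_norm {x : 𝔼} (h : 0 ≤ P.s x) : ‖P.σ x‖ ≤ ‖x‖ := by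
  simpa using P.norm_sub_map_le (x := 0) (mul_nonpos_of_nonpos_of_nonneg P.s_zero.le h)

theorem map_eq_self {x : 𝔼} (h : P.s x = 0) : P.σ x = x := by
  have := P.norm_sub_sq x x
  rw [h, sub_self, norm_zero] at this
  simp only [mul_zero, add_zero, ne_eq, OfNat.ofNat_ne_zero, not_false_eq_true, zero_pow,
    sq_eq_zero_iff, norm_eq_zero] at this
  exact (sub_eq_zero.1 this).symm

/-- Two-point rearrangement: the larger of the values at `x` and its mirror image is put on the
side of the origin. -/
noncomputable def polarize (f : 𝔼 → ℝ) (x : 𝔼) : ℝ :=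
  if P.s x ≤ 0 then max (f x) (f (P.σ x)) else min (f x) (f (P.σ x))

theorem polarize_of_nonpos {x : 𝔼} (h : P.s x ≤ 0) :
    P.polarize f x = max (f x) (f (P.σ x)) := if_pos h

theorem polarize_of_nonneg {x : 𝔼} (h : 0 ≤ P.s x) :
    P.polarize f x = min (f x) (f (P.σ x)) := by
  rcases h.eq_or_lt with h | h
  · rw [P.polarize_of_nonpos h.ge, P.map_eq_self h.symm, max_self, min_self]
  · exact if_neg (not_le.2 h)

theorem polarize_map_of_nonpos {x : 𝔼} (h : P.s x ≤ 0) :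
    P.polarize f (P.σ x) = min (f x) (f (P.σ x)) := by
  rw [P.polarize_of_nonneg (by rw [P.s_map]; linarith), P.involutive, min_comm]

theorem polarize_map_of_nonneg {x : 𝔼} (h : 0 ≤ P.s x) :
    P.polarize f (P.σ x) = max (f x) (f (P.σ x)) := by
  rw [P.polarize_of_nonpos (by rw [P.s_map]; linarith), P.involutive, max_comm]

/-- On each orbit of the reflection polarization does nothing or swaps the two values. Hence
everything that sums symmetrically over orbits is preserved. -/
theorem polarize_pair (f : 𝔼 → ℝ) (x : 𝔼) :
    P.polarize f x = f x ∧ P.polarize f (P.σ x) = f (P.σ x) ∨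
      P.polarize f x = f (P.σ x) ∧ P.polarize f (P.σ x) = f x := by
  rcases le_total (P.s x) 0 with h | h
  · rw [P.polarize_of_nonpos h, P.polarize_map_of_nonpos h]
    rcases le_total (f x) (f (P.σ x)) with h' | h' <;> simp [h']
  · rw [P.polarize_of_nonneg h, P.polarize_map_of_nonneg h]
    rcases le_total (f x) (f (P.σ x)) with h' | h' <;> simp [h']

/-- For points on the same side, maxima and minima of `L`-Lipschitz functions are compared. For
points on opposite sides, reflecting one of them brings them closer, so the crossed differences are
controlled as well. -/
theorem abs_polarize_sub_le {L : ℝ} (hf : ∀ x y, |f x - f y| ≤ L * ‖x - y‖) (hL : 0 ≤ L)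
    (x y : 𝔼) : |P.polarize f x - P.polarize f y| ≤ L * ‖x - y‖ := by
  have h1 := abs_le.1 (hf x y)
  have h2 := abs_le.1 (hf (P.σ x) (P.σ y))
  have h3 := abs_le.1 (hf (P.σ x) y)
  have h4 := abs_le.1 (hf x (P.σ y))
  rw [P.norm_map_sub_map] at h2
  rw [P.norm_map_sub] at h3
  have key : P.s x * P.s y ≤ 0 → L * ‖x - P.σ y‖ ≤ L * ‖x - y‖ := fun h =>
    mul_le_mul_of_nonneg_left (P.norm_sub_map_le h) hL
  rw [abs_le]
  rcases le_total (P.s x) 0 with hx | hx <;> rcases le_total (P.s y) 0 with hy | hy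
  · rw [P.polarize_of_nonpos hx, P.polarize_of_nonpos hy]
    constructor <;> rcases max_cases (f x) (f (P.σ x)) with h | h <;>
      rcases max_cases (f y) (f (P.σ y)) with h' | h' <;> linarith
  · have := key (mul_nonpos_of_nonpos_of_nonneg hx hy)
    rw [P.polarize_of_nonpos hx, P.polarize_of_nonneg hy]
    constructor <;> rcases max_cases (f x) (f (P.σ x)) with h | h <;>
      rcases min_cases (f y) (f (P.σ y)) with h' | h' <;> linarith
  · have := key (mul_nonpos_of_nonneg_of_nonpos hx hy)
    rw [P.polarize_of_nonneg hx, P.polarize_of_nonpos hy]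
    constructor <;> rcases min_cases (f x) (f (P.σ x)) with h | h <;>
      rcases max_cases (f y) (f (P.σ y)) with h' | h' <;> linarith
  · rw [P.polarize_of_nonneg hx, P.polarize_of_nonneg hy]
    constructor <;> rcases min_cases (f x) (f (P.σ x)) with h | h <;>
      rcases min_cases (f y) (f (P.σ y)) with h' | h' <;> linarith

theorem polarize_mem {S : Set ℝ} (hf : ∀ x, f x ∈ S) (x : 𝔼) : P.polarize f x ∈ S := by
  rcases P.polarize_pair f x with h | h <;> rw [h.1] <;> exact hf _

theorem polarize_eq_zero {R : ℝ} (hf0 : ∀ x, 0 ≤ f x) (hf : ∀ x, R < ‖x‖ → f x = 0) {x : 𝔼}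
    (hx : R < ‖x‖) : P.polarize f x = 0 := by
  rcases le_total (P.s x) 0 with h | h
  · rw [P.polarize_of_nonpos h, hf x hx, hf _ (hx.trans_le (P.norm_le_norm_map h)), max_self]
  · rw [P.polarize_of_nonneg h, hf x hx]
    exact min_eq_left (hf0 _)

/-- The reflection as a measurable equivalence. -/
noncomputable def measurableEquiv : 𝔼 ≃ᵐ 𝔼 :=
  MeasurableEquiv.ofInvolutive P.σ P.involutive P.measurePreserving.measurable

theorem integral_comp_map {F : Type*} [NormedAddCommGroup F] [NormedSpace ℝ F] (h : 𝔼 → F) :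
    ∫ x, h (P.σ x) = ∫ x, h x :=
  MeasurePreserving.integral_comp' (f := P.measurableEquiv) P.measurePreserving h

theorem integrable_comp_map {h : 𝔼 → ℝ} (hh : Integrable h) : Integrable fun x => h (P.σ x) :=
  P.measurePreserving.integrable_comp_of_integrable hh

/-- The reflection preserves volume, so an integral is half the integral of the sums over orbits. -/
theorem integral_le_integral_of_pair {h k : 𝔼 → ℝ} (hh : Integrable h) (hk : Integrable k)
    (hle : ∀ x, h x + h (P.σ x) ≤ k x + k (P.σ x)) : ∫ x, h x ≤ ∫ x, k x := by
  have h1 : ∫ x, (h x + h (P.σ x)) ≤ ∫ x, (k x + k (P.σ x)) :=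
    integral_mono (hh.add (P.integrable_comp_map hh)) (hk.add (P.integrable_comp_map hk)) hle
  rw [integral_add hh (P.integrable_comp_map hh), integral_add hk (P.integrable_comp_map hk),
    P.integral_comp_map, P.integral_comp_map] at h1
  linarith

theorem integral_polarize_mul_self (hf : Integrable fun x => f x * f x)
    (hpf : Integrable fun x => P.polarize f x * P.polarize f x) :
    ∫ x, P.polarize f x * P.polarize f x = ∫ x, f x * f x := by
  have h : ∀ x, P.polarize f x * P.polarize f x +
      P.polarize f (P.σ x) * P.polarize f (P.σ x) = f x * f x + f (P.σ x) * f (P.σ x) := fun x => by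
    rcases P.polarize_pair f x with h | h <;> rw [h.1, h.2]
    ring
  exact le_antisymm (P.integral_le_integral_of_pair hpf hf fun x => (h x).le)
    (P.integral_le_integral_of_pair hf hpf fun x => (h x).ge)

theorem volume_polarize_pos (hf : Measurable f) (hpf : Measurable (P.polarize f)) :
    volume {x | 0 < P.polarize f x} = volume {x | 0 < f x} := by
  have hmeas : ∀ {h : 𝔼 → ℝ}, Measurable h → MeasurableSet {x | 0 < h x} := fun hh =>
    measurableSet_lt measurable_const hh
  have key : ∀ {h : 𝔼 → ℝ}, Measurable h → 2 * volume {x | 0 < h x} =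
      ∫⁻ x, ({x | 0 < h x}.indicator 1 x + {x | 0 < h x}.indicator (1 : 𝔼 → ENNReal) (P.σ x)) := by
    intro h hh
    have hi : Measurable ({x | 0 < h x}.indicator (1 : 𝔼 → ENNReal)) :=
      measurable_one.indicator (hmeas hh)
    rw [lintegral_add_left hi, P.measurePreserving.lintegral_comp hi,
      lintegral_indicator_one (hmeas hh), two_mul]
  have h2 : 2 * volume {x | 0 < P.polarize f x} = 2 * volume {x | 0 < f x} := by
    rw [key hf, key hpf]
    refine lintegral_congr fun x => ?_
    simp only [Set.indicator_apply, Set.mem_ofPred_eq, Pi.one_apply]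
    rcases P.polarize_pair f x with h | h <;> rw [h.1, h.2]
    rw [add_comm]
  exact (ENNReal.mul_right_inj two_ne_zero (by simp)).1 h2

/-- Polarization puts the larger value where the weight is smaller. Equality of the integrals would
make the continuous nonnegative defect vanish everywhere, but at `p` it equals `(‖σ p‖² - ‖p‖²) (f(σ
p)² - f(p)²) > 0`. -/
theorem integral_norm_sq_polarize_lt {p : 𝔼} (hf0 : ∀ x, 0 ≤ f x) (hc : Continuous f)
    (hpc : Continuous (P.polarize f)) (hf : Integrable fun x => ‖x‖ ^ 2 * f x ^ 2)
    (hpf : Integrable fun x => ‖x‖ ^ 2 * P.polarize f x ^ 2)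
    (hp : P.s p < 0) (hlt : f p < f (P.σ p)) :
    ∫ x, ‖x‖ ^ 2 * P.polarize f x ^ 2 < ∫ x, ‖x‖ ^ 2 * f x ^ 2 := by
  have hsq : ∀ {a b : 𝔼}, ‖a‖ ≤ ‖b‖ → ‖a‖ ^ 2 ≤ ‖b‖ ^ 2 := fun h =>
    pow_le_pow_left₀ (norm_nonneg _) h 2
  have key : ∀ x, ‖x‖ ^ 2 * P.polarize f x ^ 2 + ‖P.σ x‖ ^ 2 * P.polarize f (P.σ x) ^ 2 ≤
      ‖x‖ ^ 2 * f x ^ 2 + ‖P.σ x‖ ^ 2 * f (P.σ x) ^ 2 := fun x => by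
    have h1 := hf0 x
    have h2 := hf0 (P.σ x)
    rcases le_total (P.s x) 0 with h | h
    · rw [P.polarize_of_nonpos h, P.polarize_map_of_nonpos h]
      have := hsq (P.norm_le_norm_map h)
      rcases le_total (f x) (f (P.σ x)) with h' | h' <;> simp only [h', max_eq_left, max_eq_right,
        min_eq_left, min_eq_right, le_refl]
      nlinarith [pow_le_pow_left₀ h1 h' 2]
    · rw [P.polarize_of_nonneg h, P.polarize_map_of_nonneg h]
      have := hsq (P.norm_map_le_norm h)
      rcases le_total (f x) (f (P.σ x)) with h' | h' <;> simp only [h', max_eq_left, max_eq_right,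
        min_eq_left, min_eq_right, le_refl]
      nlinarith [pow_le_pow_left₀ h2 h' 2]
  have hfσ := P.integrable_comp_map hf
  have hpfσ := P.integrable_comp_map hpf
  refine lt_of_le_of_ne (P.integral_le_integral_of_pair hpf hf key) fun heq => ?_
  have h0 : ∫ x, ((‖x‖ ^ 2 * f x ^ 2 + ‖P.σ x‖ ^ 2 * f (P.σ x) ^ 2) -
      (‖x‖ ^ 2 * P.polarize f x ^ 2 + ‖P.σ x‖ ^ 2 * P.polarize f (P.σ x) ^ 2)) = 0 := by
    have h1 : Integrable fun x => ‖x‖ ^ 2 * f x ^ 2 + ‖P.σ x‖ ^ 2 * f (P.σ x) ^ 2 := hf.add hfσ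
    have h2 : Integrable fun x =>
      ‖x‖ ^ 2 * P.polarize f x ^ 2 + ‖P.σ x‖ ^ 2 * P.polarize f (P.σ x) ^ 2 := hpf.add hpfσ
    rw [integral_sub h1 h2, integral_add hf hfσ, integral_add hpf hpfσ,
      P.integral_comp_map (fun x => ‖x‖ ^ 2 * f x ^ 2),
      P.integral_comp_map (fun x => ‖x‖ ^ 2 * P.polarize f x ^ 2), heq, sub_self]
  rw [integral_eq_zero_iff_of_nonneg (fun x => sub_nonneg.2 (key x))
    ((hf.add hfσ).sub (hpf.add hpfσ))] at h0
  have hσ := P.continuous_map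
  have hcont : Continuous fun x => (‖x‖ ^ 2 * f x ^ 2 + ‖P.σ x‖ ^ 2 * f (P.σ x) ^ 2) -
      (‖x‖ ^ 2 * P.polarize f x ^ 2 + ‖P.σ x‖ ^ 2 * P.polarize f (P.σ x) ^ 2) := by fun_prop
  have hp0 := congrFun ((hcont.ae_eq_iff_eq volume continuous_zero).1 h0) p
  simp only [P.polarize_of_nonpos hp.le, P.polarize_map_of_nonpos hp.le, max_eq_right hlt.le,
    min_eq_left hlt.le, Pi.zero_apply] at hp0
  have h1 : ‖P.σ p‖ ^ 2 = ‖p‖ ^ 2 + P.s 0 * P.s p := by simpa using P.norm_sub_sq 0 p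
  have h2 : 0 < P.s 0 * P.s p := mul_pos_of_neg_of_neg P.s_zero hp
  have h3 : f p ^ 2 < f (P.σ p) ^ 2 := pow_lt_pow_left₀ hlt (hf0 p) two_ne_zero
  rw [h1] at hp0
  nlinarith [mul_pos h2 (sub_pos.2 h3)]

theorem mul_add_mul_le_max_min (a b c d : ℝ) :
    a * c + b * d ≤ max a b * max c d + min a b * min c d := by
  rcases le_total a b with h | h <;> rcases le_total c d with h' | h' <;> simp only [h, h',
    max_eq_left, max_eq_right, min_eq_left, min_eq_right] <;>
    nlinarith [mul_nonneg (sub_nonneg.2 h) (sub_nonneg.2 h')]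

/-- Sum the integrand over the four points obtained by reflecting either variable. On them `J` takes
just the two values `J (x - y)` and `J (x - σ y)`, and the sum of the four products of values is
unchanged. Polarization aligns the order of the values so that the larger kernel value receives the
larger share. -/
theorem kernelForm_le_polarize (hJ : HypothesisH J) (hf : Integrable f)
    (hpf : Integrable (P.polarize f)) :
    kernelForm J f f ≤ kernelForm J (P.polarize f) (P.polarize f) := by
  have hid := MeasurePreserving.id (volume : Measure 𝔼)
  let e₁ : 𝔼 × 𝔼 ≃ᵐ 𝔼 × 𝔼 := P.measurableEquiv.prodCongr (MeasurableEquiv.refl _)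
  let e₂ : 𝔼 × 𝔼 ≃ᵐ 𝔼 × 𝔼 := (MeasurableEquiv.refl _).prodCongr P.measurableEquiv
  let e₃ : 𝔼 × 𝔼 ≃ᵐ 𝔼 × 𝔼 := P.measurableEquiv.prodCongr P.measurableEquiv
  have he₁ : MeasurePreserving e₁ := P.measurePreserving.prod hid
  have he₂ : MeasurePreserving e₂ := hid.prod P.measurePreserving
  have he₃ : MeasurePreserving e₃ := P.measurePreserving.prod P.measurePreserving
  have key : ∀ {h : 𝔼 → ℝ}, Integrable h → Integrable (fun p : 𝔼 × 𝔼 =>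
      h p.1 * J (p.1 - p.2) * h p.2 + h (P.σ p.1) * J (P.σ p.1 - p.2) * h p.2 +
      (h p.1 * J (p.1 - P.σ p.2) * h (P.σ p.2) +
        h (P.σ p.1) * J (P.σ p.1 - P.σ p.2) * h (P.σ p.2))) ∧ 4 * kernelForm J h h =
      ∫ p : 𝔼 × 𝔼, (h p.1 * J (p.1 - p.2) * h p.2 + h (P.σ p.1) * J (P.σ p.1 - p.2) * h p.2 +
      (h p.1 * J (p.1 - P.σ p.2) * h (P.σ p.2) +
        h (P.σ p.1) * J (P.σ p.1 - P.σ p.2) * h (P.σ p.2))) := by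
    intro h hh
    have i₀ : Integrable fun p : 𝔼 × 𝔼 => h p.1 * J (p.1 - p.2) * h p.2 :=
      hJ.integrable_kernel hh hh
    have i₁ : Integrable fun p : 𝔼 × 𝔼 => h (P.σ p.1) * J (P.σ p.1 - p.2) * h p.2 :=
      he₁.integrable_comp_of_integrable i₀
    have i₂ : Integrable fun p : 𝔼 × 𝔼 => h p.1 * J (p.1 - P.σ p.2) * h (P.σ p.2) :=
      he₂.integrable_comp_of_integrable i₀
    have i₃ : Integrable fun p : 𝔼 × 𝔼 => h (P.σ p.1) * J (P.σ p.1 - P.σ p.2) * h (P.σ p.2) :=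
      he₃.integrable_comp_of_integrable i₀
    have q₁ : ∫ p : 𝔼 × 𝔼, h (P.σ p.1) * J (P.σ p.1 - p.2) * h p.2 = kernelForm J h h :=
      he₁.integral_comp' fun p : 𝔼 × 𝔼 => h p.1 * J (p.1 - p.2) * h p.2
    have q₂ : ∫ p : 𝔼 × 𝔼, h p.1 * J (p.1 - P.σ p.2) * h (P.σ p.2) = kernelForm J h h :=
      he₂.integral_comp' fun p : 𝔼 × 𝔼 => h p.1 * J (p.1 - p.2) * h p.2
    have q₃ : ∫ p : 𝔼 × 𝔼, h (P.σ p.1) * J (P.σ p.1 - P.σ p.2) * h (P.σ p.2) =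
        kernelForm J h h :=
      he₃.integral_comp' fun p : 𝔼 × 𝔼 => h p.1 * J (p.1 - p.2) * h p.2
    have i₀₁ := i₀.add i₁
    have i₂₃ := i₂.add i₃
    refine ⟨i₀₁.add i₂₃, ?_⟩
    have := integral_add i₀₁ i₂₃
    simp only [Pi.add_apply] at this
    rw [this, integral_add i₀ i₁, integral_add i₂ i₃, q₁, q₂, q₃, kernelForm]
    ring
  have hf4 := key hf
  have hp4 := key hpf
  suffices h : 4 * kernelForm J f f ≤ 4 * kernelForm J (P.polarize f) (P.polarize f) by linarith
  rw [hf4.2, hp4.2]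
  refine integral_mono hf4.1 hp4.1 fun p => ?_
  obtain ⟨x, y⟩ := p
  simp only
  have e1 : J (P.σ x - P.σ y) = J (x - y) := hJ.radial _ _ (P.norm_map_sub_map x y)
  have e2 : J (P.σ x - y) = J (x - P.σ y) := hJ.radial _ _ (P.norm_map_sub x y)
  rw [e1, e2]
  have r1 := mul_add_mul_le_max_min (f x) (f (P.σ x)) (f y) (f (P.σ y))
  have r2 := mul_add_mul_le_max_min (f x) (f (P.σ x)) (f (P.σ y)) (f y)
  rw [max_comm (f (P.σ y)), min_comm (f (P.σ y))] at r2
  have sx := max_add_min (f x) (f (P.σ x))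
  have sy := max_add_min (f y) (f (P.σ y))
  have hab : 0 ≤ P.s x * P.s y → J (x - P.σ y) ≤ J (x - y) := fun h =>
    hJ.radially_decreasing _ _ (P.norm_sub_le h)
  have hba : P.s x * P.s y ≤ 0 → J (x - y) ≤ J (x - P.σ y) := fun h =>
    hJ.radially_decreasing _ _ (P.norm_sub_map_le h)
  have tot : (f x + f (P.σ x)) * (f y + f (P.σ y)) =
      (max (f x) (f (P.σ x)) + min (f x) (f (P.σ x))) *
        (max (f y) (f (P.σ y)) + min (f y) (f (P.σ y))) := by rw [sx, sy]
  have tota := congrArg (J (x - y) * ·) tot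
  have totb := congrArg (J (x - P.σ y) * ·) tot
  rcases le_total (P.s x) 0 with hx | hx <;> rcases le_total (P.s y) 0 with hy | hy
  · rw [P.polarize_of_nonpos hx, P.polarize_map_of_nonpos hx, P.polarize_of_nonpos hy,
      P.polarize_map_of_nonpos hy]
    linarith [mul_nonneg (sub_nonneg.2 (hab (mul_nonneg_of_nonpos_of_nonpos hx hy)))
      (sub_nonneg.2 r1)]
  · rw [P.polarize_of_nonpos hx, P.polarize_map_of_nonpos hx, P.polarize_of_nonneg hy,
      P.polarize_map_of_nonneg hy]
    linarith [mul_nonneg (sub_nonneg.2 (hba (mul_nonpos_of_nonpos_of_nonneg hx hy)))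
      (sub_nonneg.2 r2)]
  · rw [P.polarize_of_nonneg hx, P.polarize_map_of_nonneg hx, P.polarize_of_nonpos hy,
      P.polarize_map_of_nonpos hy]
    linarith [mul_nonneg (sub_nonneg.2 (hba (mul_nonpos_of_nonneg_of_nonpos hx hy)))
      (sub_nonneg.2 r2)]
  · rw [P.polarize_of_nonneg hx, P.polarize_map_of_nonneg hx, P.polarize_of_nonneg hy,
      P.polarize_map_of_nonneg hy]
    linarith [mul_nonneg (sub_nonneg.2 (hab (mul_nonneg hx hy))) (sub_nonneg.2 r1)]

end HyperplaneReflection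

end Polarization

/-! ### The Faber–Krahn inequality by compactness and polarization. -/

section FaberKrahn

open Filter Topology

variable {N : ℕ}

local notation "𝔼" => EuclideanSpace ℝ (Fin N)

/-- Lipschitz functions with values in `[0, M]` vanishing outside the ball of radius `R`. -/
structure IsLipschitzBump (L M R : ℝ) (g : 𝔼 → ℝ) : Prop where
  lipschitz : ∀ x y, |g x - g y| ≤ L * ‖x - y‖
  mem_Icc : ∀ x, g x ∈ Set.Icc 0 M
  eq_zero : ∀ x, R < ‖x‖ → g x = 0

namespace IsLipschitzBump

variable {L M R : ℝ} {J g : EuclideanSpace ℝ (Fin N) → ℝ}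

theorem lipschitzWith (hg : IsLipschitzBump L M R g) : LipschitzWith L.toNNReal g :=
  LipschitzWith.of_dist_le' fun x y => by
    rw [Real.dist_eq, dist_eq_norm]; exact hg.lipschitz x y

theorem continuous (hg : IsLipschitzBump L M R g) : Continuous g := hg.lipschitzWith.continuous

theorem polarize (hg : IsLipschitzBump L M R g) (hL : 0 ≤ L) (P : HyperplaneReflection N) :
    IsLipschitzBump L M R (P.polarize g) :=
  ⟨P.abs_polarize_sub_le hg.lipschitz hL, P.polarize_mem hg.mem_Icc,
    fun _ hx => P.polarize_eq_zero (fun x => (hg.mem_Icc x).1) hg.eq_zero hx⟩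

theorem le_indicator (hg : IsLipschitzBump L M R g) (x : 𝔼) :
    |g x| ≤ (Metric.closedBall (0 : 𝔼) R).indicator (fun _ => M) x := by
  by_cases hx : x ∈ Metric.closedBall (0 : 𝔼) R
  · rw [Set.indicator_of_mem hx, abs_of_nonneg (hg.mem_Icc x).1]
    exact (hg.mem_Icc x).2
  · rw [Set.indicator_of_notMem hx, hg.eq_zero x (by simpa using hx), abs_zero]

theorem integrable_bound (M R : ℝ) :
    Integrable ((Metric.closedBall (0 : 𝔼) R).indicator fun _ => M) :=
  (integrable_indicator_iff measurableSet_closedBall).2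
    (integrableOn_const measure_closedBall_lt_top.ne)

theorem integrable (hg : IsLipschitzBump L M R g) : Integrable g :=
  (integrable_bound M R).mono' hg.continuous.aestronglyMeasurable (.of_forall hg.le_indicator)

theorem norm_mul_self_le (hg : IsLipschitzBump L M R g) (x : 𝔼) :
    ‖g x * g x‖ ≤ (Metric.closedBall (0 : 𝔼) R).indicator (fun _ => M * M) x := by
  have h := hg.le_indicator x
  rw [norm_mul, Real.norm_eq_abs]
  by_cases hx : x ∈ Metric.closedBall (0 : 𝔼) R
  · rw [Set.indicator_of_mem hx] at h ⊢
    exact mul_self_le_mul_self (abs_nonneg _) h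
  · rw [Set.indicator_of_notMem hx] at h ⊢
    nlinarith [abs_nonneg (g x)]

theorem norm_weight_le (hg : IsLipschitzBump L M R g) (x : 𝔼) :
    ‖‖x‖ ^ 2 * g x ^ 2‖ ≤ (Metric.closedBall (0 : 𝔼) R).indicator (fun _ => R ^ 2 * (M * M)) x := by
  have h := hg.norm_mul_self_le x
  rw [norm_mul, norm_pow, norm_norm, pow_two (g x)]
  by_cases hx : x ∈ Metric.closedBall (0 : 𝔼) R
  · rw [Set.indicator_of_mem hx] at h ⊢
    gcongr
    simpa using hx
  · rw [Set.indicator_of_notMem hx] at h ⊢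
    have : ‖g x * g x‖ = 0 := le_antisymm h (norm_nonneg _)
    rw [this, mul_zero]

theorem norm_kernel_le (hJ : HypothesisH J) (hg : IsLipschitzBump L M R g) (p : 𝔼 × 𝔼) :
    ‖g p.1 * J (p.1 - p.2) * g p.2‖ ≤ J 0 *
      ((Metric.closedBall (0 : 𝔼) R).indicator (fun _ => M) p.1 *
        (Metric.closedBall (0 : 𝔼) R).indicator (fun _ => M) p.2) := by
  have h1 := hg.le_indicator p.1
  have h2 := hg.le_indicator p.2
  calc ‖g p.1 * J (p.1 - p.2) * g p.2‖ = ‖J (p.1 - p.2)‖ * (|g p.1| * |g p.2|) := by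
        rw [norm_mul, norm_mul, Real.norm_eq_abs (g _), Real.norm_eq_abs (g _)]; ring
    _ ≤ _ := mul_le_mul (hJ.norm_le _) (mul_le_mul h1 h2 (abs_nonneg _) ((abs_nonneg _).trans h1))
        (by positivity) hJ.pos_zero.le

theorem integrable_mul_self (hg : IsLipschitzBump L M R g) : Integrable fun x => g x * g x :=
  (integrable_bound _ R).mono' (hg.continuous.mul hg.continuous).aestronglyMeasurable
    (.of_forall hg.norm_mul_self_le)

theorem integrable_weight (hg : IsLipschitzBump L M R g) :
    Integrable fun x => ‖x‖ ^ 2 * g x ^ 2 :=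
  (integrable_bound _ R).mono'
    ((continuous_norm.pow 2).mul (hg.continuous.pow 2)).aestronglyMeasurable
    (.of_forall hg.norm_weight_le)

/-- The defining conditions are closed for pointwise convergence inside a product of intervals `[0,
M]`, compact by Tychonoff; the common Lipschitz constant gives equicontinuity, and Arzelà–Ascoli
concludes. -/
theorem isCompact (L M R : ℝ) : IsCompact {g : C(𝔼, ℝ) | IsLipschitzBump L M R g} := by
  refine ArzelaAscoli.isCompact_of_equicontinuous _ ?_ ?_
  · have himg : ContinuousMap.toFun '' {g : C(𝔼, ℝ) | IsLipschitzBump L M R g} =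
        {g : 𝔼 → ℝ | IsLipschitzBump L M R g} := by
      ext g
      constructor
      · rintro ⟨g, hg, rfl⟩; exact hg
      · intro hg; exact ⟨⟨g, IsLipschitzBump.continuous hg⟩, hg, rfl⟩
    rw [himg]
    refine IsCompact.of_isClosed_subset
      (isCompact_univ_pi fun _ : 𝔼 => isCompact_Icc (a := (0 : ℝ)) (b := M)) ?_
      fun g hg x _ => hg.mem_Icc x
    have : {g : 𝔼 → ℝ | IsLipschitzBump L M R g} =
        (⋂ x, ⋂ y, {g | |g x - g y| ≤ L * ‖x - y‖}) ∩ (⋂ x, {g | g x ∈ Set.Icc 0 M}) ∩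
          ⋂ x, {g | R < ‖x‖ → g x = 0} := by
      ext g
      simp only [Set.mem_inter_iff, Set.mem_iInter, Set.mem_ofPred_eq]
      exact ⟨fun h => ⟨⟨h.1, h.2⟩, h.3⟩, fun h => ⟨h.1.1, h.1.2, h.2⟩⟩
    rw [this]
    refine ((isClosed_iInter fun x => isClosed_iInter fun y => ?_).inter
      (isClosed_iInter fun x => ?_)).inter (isClosed_iInter fun x => ?_)
    · exact isClosed_le (by fun_prop) continuous_const
    · exact isClosed_Icc.preimage (continuous_apply x)
    · by_cases hx : R < ‖x‖
      · simpa [hx] using isClosed_eq (continuous_apply x) continuous_const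
      · simp [hx]
  · exact (LipschitzWith.uniformEquicontinuous _ L.toNNReal
      fun g => IsLipschitzBump.lipschitzWith g.2).equicontinuous

/-- The common bound and support provide a dominating function; local uniform convergence alone
would not control the integral. -/
theorem continuousOn_integral_mul_self (L M R : ℝ) :
    ContinuousOn (fun g : C(𝔼, ℝ) => ∫ x, g x * g x) {g | IsLipschitzBump L M R g} := by
  rw [continuousOn_iff_continuous_domRestrict]
  refine continuous_of_dominated (fun g => ?_)
    (fun g => .of_forall fun x => norm_mul_self_le g.2 x) (integrable_bound _ R)
    (.of_forall fun x => ?_)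
  · exact (g.1.continuous.mul g.1.continuous).aestronglyMeasurable
  · have : Continuous fun g : {g : C(𝔼, ℝ) | IsLipschitzBump L M R g} => g.1 x :=
      (ContinuousEvalConst.continuous_eval_const x).comp continuous_subtype_val
    exact this.mul this

theorem continuousOn_integral_weight (L M R : ℝ) :
    ContinuousOn (fun g : C(𝔼, ℝ) => ∫ x, ‖x‖ ^ 2 * g x ^ 2) {g | IsLipschitzBump L M R g} := by
  rw [continuousOn_iff_continuous_domRestrict]
  refine continuous_of_dominated (fun g => ?_)
    (fun g => .of_forall fun x => norm_weight_le g.2 x) (integrable_bound _ R)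
    (.of_forall fun x => ?_)
  · exact ((continuous_norm.pow 2).mul (g.1.continuous.pow 2)).aestronglyMeasurable
  · have : Continuous fun g : {g : C(𝔼, ℝ) | IsLipschitzBump L M R g} => g.1 x :=
      (ContinuousEvalConst.continuous_eval_const x).comp continuous_subtype_val
    exact continuous_const.mul (this.pow 2)

theorem continuousOn_kernelForm (hJ : HypothesisH J) (L M R : ℝ) :
    ContinuousOn (fun g : C(𝔼, ℝ) => kernelForm J g g) {g | IsLipschitzBump L M R g} := by
  rw [continuousOn_iff_continuous_domRestrict]
  refine continuous_of_dominated (fun g => ?_)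
    (fun g => .of_forall fun p => norm_kernel_le hJ g.2 p)
    (((integrable_bound M R).mul_prod (integrable_bound M R)).const_mul (J 0))
    (.of_forall fun p => ?_)
  · exact (hJ.integrable_kernel (integrable g.2) (integrable g.2)).aestronglyMeasurable
  · have : ∀ x, Continuous fun g : {g : C(𝔼, ℝ) | IsLipschitzBump L M R g} => g.1 x := fun x =>
      (ContinuousEvalConst.continuous_eval_const x).comp continuous_subtype_val
    exact ((this _).mul continuous_const).mul (this _)

end IsLipschitzBump

/-- Volume of positivity is lower semicontinuous: a compact subset of `{g > 0}` of volume above `V`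
stays in the positivity set of every function near `g` in the compact-open topology. -/
theorem isClosed_volume_pos_le (V : ENNReal) :
    IsClosed {g : C(𝔼, ℝ) | volume {x | 0 < g x} ≤ V} := by
  rw [← isOpen_compl_iff, isOpen_iff_mem_nhds]
  intro g hg
  have hg' : V < volume {x | 0 < g x} := not_le.1 hg
  have ho : IsOpen {x | 0 < g x} := isOpen_lt continuous_const g.continuous
  obtain ⟨K, hKs, hK, hVK⟩ := ho.exists_lt_isCompact hg'
  have hnhds : {h : C(𝔼, ℝ) | Set.MapsTo h K (Set.Ioi 0)} ∈ 𝓝 g :=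
    (ContinuousMap.isOpen_setOfPred_mapsTo hK isOpen_Ioi).mem_nhds hKs
  filter_upwards [hnhds] with h hh
  exact not_le.2 (hVK.trans_le (measure_mono hh))

theorem volume_ball_zero_lt (hN : 1 ≤ N) {r r' : ℝ} (hr : 0 < r) (h : r < r') :
    volume (Metric.ball (0 : 𝔼) r) < volume (Metric.ball (0 : 𝔼) r') := by
  rw [Measure.addHaar_ball_of_pos _ _ hr, Measure.addHaar_ball_of_pos _ _ (hr.trans h)]
  refine (ENNReal.mul_lt_mul_iff_left (Metric.measure_ball_pos _ _ one_pos).ne'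
    measure_ball_lt_top.ne).2 ((ENNReal.ofReal_lt_ofReal_iff (pow_pos (hr.trans h) _)).2 ?_)
  rw [finrank_euclideanSpace_fin]
  exact pow_lt_pow_left₀ h hr.le (by omega)

variable {J f : EuclideanSpace ℝ (Fin N) → ℝ} {L M R r κ : ℝ}

/-- Minimizing the second moment over the compact class `C` replaces an infinite sequence of
polarizations: the minimizer cannot be improved by any of them, so it is radially decreasing and
lives in the ball, where the hypothesis on `κ` applies. -/
theorem IsLipschitzBump.kernelForm_le (hJ : HypothesisH J) (hN : 1 ≤ N) (hr : 0 < r) (hL : 0 ≤ L)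
    (hκ : ∀ g, SupportedL2 (Metric.ball 0 r) g → kernelForm J g g ≤ κ * ∫ x, g x * g x)
    (hf : IsLipschitzBump L M R f) (hvol : volume {x | 0 < f x} ≤ volume (Metric.ball (0 : 𝔼) r)) :
    kernelForm J f f ≤ κ * ∫ x, f x * f x := by
  let C : Set C(𝔼, ℝ) := {g | IsLipschitzBump L M R g ∧ (∫ x, g x * g x = ∫ x, f x * f x) ∧
    kernelForm J f f ≤ kernelForm J g g ∧
    volume {x | 0 < g x} ≤ volume (Metric.ball (0 : 𝔼) r)}
  have hCc : IsCompact C := by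
    have h0 := IsLipschitzBump.isCompact (N := N) L M R
    have h1 := h0.isClosed
    have c1 := (IsLipschitzBump.continuousOn_integral_mul_self L M R).preimage_isClosed_of_isClosed
      h1 (isClosed_singleton (x := ∫ x, f x * f x))
    have c2 := (IsLipschitzBump.continuousOn_kernelForm hJ L M R).preimage_isClosed_of_isClosed
      h1 (isClosed_Ici (a := kernelForm J f f))
    have c3 := isClosed_volume_pos_le (N := N) (volume (Metric.ball (0 : 𝔼) r))
    refine h0.of_isClosed_subset (t := C) ?_ fun g hg => hg.1
    convert (c1.inter c2).inter c3 using 1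
    ext g
    exact ⟨fun h => ⟨⟨⟨h.1, h.2.1⟩, h.1, h.2.2.1⟩, h.2.2.2⟩,
      fun h => ⟨h.1.1.1, h.1.1.2, h.1.2.2, h.2⟩⟩
  obtain ⟨g, ⟨hg, hgn, hgQ, hgv⟩, hmin⟩ := hCc.exists_isMinOn
    ⟨⟨f, hf.continuous⟩, hf, rfl, le_rfl, hvol⟩
    ((IsLipschitzBump.continuousOn_integral_weight L M R).mono fun g hg => hg.1)
  -- Otherwise the reflection exchanging `p` and `q` gives a polarized function still in `C` with
  -- strictly smaller second moment.
  have hanti : ∀ p q : 𝔼, ‖p‖ < ‖q‖ → g q ≤ g p := by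
    intro p q hpq
    by_contra! hlt
    obtain ⟨P, hσ, hs⟩ := exists_hyperplaneReflection hpq
    have hP := hg.polarize hL P
    have hlt' := P.integral_norm_sq_polarize_lt (fun x => (hg.mem_Icc x).1) hg.continuous
      hP.continuous hg.integrable_weight hP.integrable_weight hs (by rwa [hσ])
    have hmem : (⟨P.polarize g, hP.continuous⟩ : C(𝔼, ℝ)) ∈ C := by
      refine ⟨hP, ?_, ?_, ?_⟩
      · exact (P.integral_polarize_mul_self hg.integrable_mul_self hP.integrable_mul_self).trans hgn
      · exact hgQ.trans (P.kernelForm_le_polarize hJ hg.integrable hP.integrable)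
      · exact (P.volume_polarize_pos hg.continuous.measurable hP.continuous.measurable).trans_le hgv
    exact not_le.2 hlt' (isMinOn_iff.1 hmin _ hmem)
  have hsupp : ∀ q ∉ Metric.ball (0 : 𝔼) r, g q = 0 := by
    intro q hq
    rw [mem_ball_zero_iff, not_lt] at hq
    by_contra hne
    have hpos : 0 < g q := lt_of_le_of_ne (hg.mem_Icc q).1 (Ne.symm hne)
    have hcont : Continuous fun t : ℝ => g (t • q) := by
      have := hg.continuous
      fun_prop
    have hev : ∀ᶠ t in 𝓝 (1 : ℝ), 0 < g (t • q) :=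
      hcont.continuousAt.eventually_const_lt (by simpa using hpos)
    -- Moving slightly outwards is needed when `‖q‖ = r`: only a ball of radius strictly above `r`
    -- inside the positivity set contradicts the volume bound.
    obtain ⟨t, ht, ht1⟩ := ((hev.filter_mono nhdsWithin_le_nhds).and
      (self_mem_nhdsWithin (a := (1 : ℝ)) (s := Set.Ioi 1))).exists
    have ht1' : (1 : ℝ) < t := ht1
    have hlt : r < ‖t • q‖ := by
      rw [norm_smul, Real.norm_of_nonneg (by linarith)]
      nlinarith
    have hsub : Metric.ball (0 : 𝔼) ‖t • q‖ ⊆ {x | 0 < g x} := fun x hx =>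
      ht.trans_le (hanti x _ (by simpa using hx))
    exact not_le.2 (volume_ball_zero_lt hN hr hlt) ((measure_mono hsub).trans hgv)
  have hgS : SupportedL2 (Metric.ball 0 r) g := by
    refine ⟨(memLp_two_iff_integrable_sq hg.continuous.aestronglyMeasurable).2 ?_, hsupp⟩
    simpa only [pow_two] using hg.integrable_mul_self
  rw [← hgn]
  exact hgQ.trans (hκ g hgS)

/-- The Lipschitz regularization `x ↦ inf_y (f(y) + n ‖x - y‖)`. -/
noncomputable def lipschitzRegularization (n : ℕ) (f : 𝔼 → ℝ) (x : 𝔼) : ℝ :=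
  ⨅ y, f y + n * ‖x - y‖

theorem bddBelow_regularization (hf0 : ∀ x, 0 ≤ f x) (n : ℕ) (x : 𝔼) :
    BddBelow (Set.range fun y => f y + n * ‖x - y‖) :=
  ⟨0, by rintro _ ⟨y, rfl⟩; exact add_nonneg (hf0 y) (by positivity)⟩

theorem lipschitzRegularization_nonneg (hf0 : ∀ x, 0 ≤ f x) (n : ℕ) (x : 𝔼) : 0 ≤ lipschitzRegularization n f x :=
  le_ciInf fun y => add_nonneg (hf0 y) (by positivity)

theorem lipschitzRegularization_le (hf0 : ∀ x, 0 ≤ f x) (n : ℕ) (x : 𝔼) : lipschitzRegularization n f x ≤ f x :=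
  (ciInf_le (bddBelow_regularization hf0 n x) x).trans (by simp)

theorem abs_lipschitzRegularization_sub_le (hf0 : ∀ x, 0 ≤ f x) (n : ℕ) (x y : 𝔼) :
    |lipschitzRegularization n f x - lipschitzRegularization n f y| ≤ n * ‖x - y‖ := by
  have key : ∀ x y : 𝔼, lipschitzRegularization n f x ≤
      lipschitzRegularization n f y + n * ‖x - y‖ := fun x y => by
    rw [← sub_le_iff_le_add]
    refine le_ciInf fun z => ?_
    rw [sub_le_iff_le_add]
    refine (ciInf_le (bddBelow_regularization hf0 n x) z).trans ?_
    have := norm_sub_le_norm_sub_add_norm_sub x y z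
    have hn : (0 : ℝ) ≤ n := n.cast_nonneg
    nlinarith
  rw [abs_le]
  have h1 := key x y
  have h2 := key y x
  rw [norm_sub_rev] at h2
  constructor <;> linarith

/-- For `b < f x`, lower semicontinuity keeps `f y > b` within distance `δ` of `x`; farther away the
penalty alone is at least `n δ ≥ b`. -/
theorem tendsto_lipschitzRegularization (hf0 : ∀ x, 0 ≤ f x) (hlsc : LowerSemicontinuous f) (x : 𝔼) :
    Tendsto (fun n => lipschitzRegularization n f x) atTop (𝓝 (f x)) := by
  rw [tendsto_order]
  refine ⟨fun a ha => ?_, fun a ha => .of_forall fun n =>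
    (lipschitzRegularization_le hf0 n x).trans_lt ha⟩
  obtain ⟨b, hab, hb⟩ := exists_between ha
  obtain ⟨δ, hδ, hball⟩ := Metric.eventually_nhds_iff.1 (hlsc x b hb)
  obtain ⟨n₀, hn₀⟩ := exists_nat_ge (b / δ)
  filter_upwards [eventually_ge_atTop n₀] with n hn
  refine hab.trans_le (le_ciInf fun y => ?_)
  by_cases hy : dist y x < δ
  · have := hball hy
    have : 0 ≤ n * ‖x - y‖ := by positivity
    linarith
  · rw [not_lt, dist_comm, dist_eq_norm] at hy
    have h1 : b / δ ≤ n := hn₀.trans (by exact_mod_cast hn)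
    rw [div_le_iff₀ hδ] at h1
    have hn' : (0 : ℝ) ≤ n := n.cast_nonneg
    nlinarith [hf0 y, mul_le_mul_of_nonneg_left hy hn']

/-- Among nonnegative functions positive on a set of volume at most that of a ball, the quadratic
form is controlled by its bound on the ball. -/
theorem kernelForm_le_of_volume_le_ball (hJ : HypothesisH J) (hN : 1 ≤ N) (hr : 0 < r)
    (hκ : ∀ g, SupportedL2 (Metric.ball 0 r) g → kernelForm J g g ≤ κ * ∫ x, g x * g x)
    (hlsc : LowerSemicontinuous f) (hf : ∀ x, f x ∈ Set.Icc 0 M) (hfR : ∀ x, R < ‖x‖ → f x = 0)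
    (hvol : volume {x | 0 < f x} ≤ volume (Metric.ball (0 : 𝔼) r)) :
    kernelForm J f f ≤ κ * ∫ x, f x * f x := by
  have hf0 : ∀ x, 0 ≤ f x := fun x => (hf x).1
  have hle := fun n => lipschitzRegularization_le hf0 n
  have hge := fun n => lipschitzRegularization_nonneg hf0 n
  have hlim := tendsto_lipschitzRegularization hf0 hlsc
  have hbump : ∀ n : ℕ, IsLipschitzBump n M R (lipschitzRegularization n f) := fun n =>
    ⟨abs_lipschitzRegularization_sub_le hf0 n,
      fun x => ⟨hge n x, (hle n x).trans (hf x).2⟩,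
      fun x hx => le_antisymm ((hle n x).trans (hfR x hx).le) (hge n x)⟩
  have h1 : Tendsto (fun n => ∫ x, lipschitzRegularization n f x * lipschitzRegularization n f x)
      atTop (𝓝 (∫ x, f x * f x)) := by
    refine tendsto_integral_of_dominated_convergence _
      (fun n => ((hbump n).continuous.mul (hbump n).continuous).aestronglyMeasurable)
      (IsLipschitzBump.integrable_bound (M * M) R)
      (fun n => .of_forall (hbump n).norm_mul_self_le) (.of_forall fun x => (hlim x).mul (hlim x))
  have h2 : Tendsto (fun n => kernelForm J (lipschitzRegularization n f)
      (lipschitzRegularization n f)) atTop (𝓝 (kernelForm J f f)) := by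
    have hb := IsLipschitzBump.integrable_bound (N := N) M R
    refine tendsto_integral_of_dominated_convergence _
      (fun n => (hJ.integrable_kernel (hbump n).integrable
        (hbump n).integrable).aestronglyMeasurable)
      ((hb.mul_prod hb).const_mul (J 0))
      (fun n => .of_forall ((hbump n).norm_kernel_le hJ))
      (.of_forall fun p => ((hlim p.1).mul_const _).mul (hlim p.2))
  refine le_of_tendsto_of_tendsto' h2 (h1.const_mul κ) fun n => ?_
  -- The regularizations lie below `f`, so their positivity sets satisfy the same volume bound.
  refine (hbump n).kernelForm_le hJ hN hr n.cast_nonneg hκ ((measure_mono fun x hx => ?_).trans hvol)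
  exact lt_of_lt_of_le hx (hle n x)

end FaberKrahn

/-! ### The bound `μ₂ ≤ κ` and the variational property of `μ₂`. -/

section SecondEigenvalue

open Filter Topology

variable {N : ℕ}

local notation "𝔼" => EuclideanSpace ℝ (Fin N)

variable {J u : EuclideanSpace ℝ (Fin N) → ℝ} {Ω : Set (EuclideanSpace ℝ (Fin N))}
  {r κ lam : ℝ}

/-- An eigenfunction may jump at the boundary of `Ω`, so its positive part extended by zero is in
general only lower semicontinuous; this is the regularity required by
`kernelForm_le_of_volume_le_ball`. -/
theorem IsOpen.lowerSemicontinuous_indicator_max_zero (hΩ : IsOpen Ω) {w : 𝔼 → ℝ}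
    (hw : Continuous w) : LowerSemicontinuous (Ω.indicator fun x => max (w x) 0) := by
  intro x y hy
  have hc : Continuous fun x => max (w x) 0 := hw.max continuous_const
  by_cases hx : x ∈ Ω
  · rw [Set.indicator_of_mem hx] at hy
    filter_upwards [hΩ.mem_nhds hx, hc.continuousAt.eventually_const_lt hy] with z hz hz'
    rwa [Set.indicator_of_mem hz]
  · rw [Set.indicator_of_notMem hx] at hy
    exact .of_forall fun z => hy.trans_le (Set.indicator_nonneg (fun _ _ => le_max_right _ _) z)

/-- Chain `μ ∫ (u⁺)² ≤ Q(u⁺) ≤ κ ∫ (u⁺)²` and divide. As `μ > 0`, `u` has a representative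
continuous on `Ω`, to which Faber–Krahn applies. -/
theorem IsEigenfunction.one_sub_le_of_volume_pos_le (hJ : HypothesisH J) (hN : 1 ≤ N) (hr : 0 < r)
    (hκ : ∀ g, SupportedL2 (Metric.ball 0 r) g → kernelForm J g g ≤ κ * ∫ x, g x * g x)
    (hΩ : IsOpen Ω) (hb : Bornology.IsBounded Ω) (hu : IsEigenfunction J Ω u lam)
    (hlam : 0 < 1 - lam) (hu0 : ¬ ∀ᵐ x, u x ≤ 0)
    (hvol : volume {x | 0 < u x} ≤ volume (Metric.ball (0 : 𝔼) r)) : 1 - lam ≤ κ := by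
  obtain ⟨w, hw, ⟨C, hC⟩, hwu⟩ := hu.exists_continuous hJ hb hlam.ne'
  obtain ⟨R, hR⟩ := hb.subset_closedBall 0
  have hae : (Ω.indicator fun x => max (w x) 0) =ᵐ[volume] fun x => max (u x) 0 := by
    filter_upwards [(ae_restrict_iff' hΩ.measurableSet).1 hwu] with x hx
    by_cases h : x ∈ Ω
    · rw [Set.indicator_of_mem h, hx h]
    · rw [Set.indicator_of_notMem h, hu.eq_zero_of_notMem x h, max_self]
  have hset : volume {x | 0 < Ω.indicator (fun x => max (w x) 0) x} = volume {x | 0 < u x} := by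
    refine measure_congr ?_
    filter_upwards [hae] with x hx
    refine propext (Iff.of_eq ?_)
    change (0 < _) = (0 < u x)
    rw [hx]; simp
  have h1 := kernelForm_le_of_volume_le_ball (M := max C 0) (R := R) hJ hN hr hκ
    (hΩ.lowerSemicontinuous_indicator_max_zero hw)
    (fun x => ⟨Set.indicator_nonneg (fun _ _ => le_max_right _ _) x,
      Set.indicator_le' (fun x _ => max_le_max ((le_abs_self _).trans (hC x)) le_rfl)
        (fun _ _ => le_max_right _ _) x⟩)
    (fun x hx => Set.indicator_of_notMem
      (fun h => not_le.2 hx (mem_closedBall_zero_iff.1 (hR h))) _)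
    (hset.trans_le hvol)
  have hsq := integral_congr_ae (hae.mul hae)
  simp only [Pi.mul_apply] at hsq
  rw [kernelForm_congr_ae hae hae, hsq] at h1
  have h2 := hu.le_kernelForm_max_zero hJ hb
  have h3 : 0 < ∫ x, max (u x) 0 * max (u x) 0 :=
    hu.supportedL2.max_zero.integral_mul_self_pos fun h => hu0 (by
      filter_upwards [h] with x hx
      exact max_eq_right_iff.1 hx)
  exact le_of_mul_le_mul_right (h2.trans h1) h3

theorem nullMeasurableSet_pos (hu : SupportedL2 Ω u) : NullMeasurableSet {x | 0 < u x} :=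
  nullMeasurableSet_lt aemeasurable_const hu.memLp.aestronglyMeasurable.aemeasurable

theorem SupportedL2.pos_subset (hu : SupportedL2 Ω u) : {x | 0 < u x} ⊆ Ω := fun x hx => by
  by_contra h
  exact (show 0 < u x from hx).ne' (hu.eq_zero_of_notMem x h)

theorem volume_pos_le_or_le {V : ENNReal} (hV : volume Ω = V + V) (hu : SupportedL2 Ω u)
    {v : 𝔼 → ℝ} (hv : SupportedL2 Ω v) (hd : ∀ᵐ x, ¬ (0 < u x ∧ 0 < v x)) :
    volume {x | 0 < u x} ≤ V ∨ volume {x | 0 < v x} ≤ V := by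
  by_contra! h
  have hdis : AEDisjoint volume {x | 0 < u x} {x | 0 < v x} := by
    have := ae_iff.1 hd
    simp only [not_not] at this
    exact this
  have h1 := measure_union₀ (nullMeasurableSet_pos hv) hdis
  have h2 : volume ({x | 0 < u x} ∪ {x | 0 < v x}) ≤ volume Ω :=
    measure_mono (Set.union_subset hu.pos_subset hv.pos_subset)
  rw [h1, hV] at h2
  exact not_lt.2 h2 (ENNReal.add_lt_add h.1 h.2)

/-- Eigenfunctions for large eigenvalues of the convolution operator have constant sign, and are
nonzero on a large set. -/
theorem IsEigenfunction.exists_nonneg (hJ : HypothesisH J) (hN : 1 ≤ N) (hr : 0 < r)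
    (hκ : ∀ g, SupportedL2 (Metric.ball 0 r) g → kernelForm J g g ≤ κ * ∫ x, g x * g x)
    (hκ0 : 0 ≤ κ) (hΩ : IsOpen Ω) (hb : Bornology.IsBounded Ω)
    (hvol : volume Ω = volume (Metric.ball (0 : 𝔼) r) + volume (Metric.ball (0 : 𝔼) r))
    (hu : IsEigenfunction J Ω u lam) (hlam : κ < 1 - lam) :
    ∃ v, (v = u ∨ v = fun x => -u x) ∧ IsEigenfunction J Ω v lam ∧ (∀ᵐ x, 0 ≤ v x) ∧
      volume (Metric.ball (0 : 𝔼) r) < volume {x | 0 < v x} := by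
  have key : ∀ {v}, IsEigenfunction J Ω v lam → (¬ ∀ᵐ x, v x ≤ 0) →
      volume (Metric.ball (0 : 𝔼) r) < volume {x | 0 < v x} := fun hv h0 => by
    by_contra! h
    exact not_le.2 hlam
      (hv.one_sub_le_of_volume_pos_le hJ hN hr hκ hΩ hb (hκ0.trans_lt hlam) h0 h)
  by_cases h1 : ∀ᵐ x, u x ≤ 0
  · refine ⟨_, Or.inr rfl, hu.neg, ?_, key hu.neg fun h2 => hu.ne_zero ?_⟩
    · filter_upwards [h1] with x hx
      linarith
    · filter_upwards [h1, h2] with x hx hx'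
      exact le_antisymm hx (neg_nonpos.1 hx')
  · refine ⟨u, Or.inl rfl, hu, ?_, key hu h1⟩
    by_contra h2
    have h2' : ¬ ∀ᵐ x, -u x ≤ 0 := by simpa using h2
    rcases volume_pos_le_or_le hvol hu.supportedL2 hu.neg.supportedL2
      (.of_forall fun x hx => by linarith [hx.1, hx.2]) with h | h
    · exact not_lt.2 h (key hu h1)
    · exact not_lt.2 h (key hu.neg h2')

/-- If `μ₂ > κ`, two orthogonal eigenfunctions of constant sign would each occupy more than half of
`Ω`; the ordering by modulus leaves the separate case `μ₁ < 0`. -/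
theorem IsSecondEigenvalue.one_sub_le (hJ : HypothesisH J) (hN : 1 ≤ N) (hr : 0 < r)
    (hκ : ∀ g, SupportedL2 (Metric.ball 0 r) g → kernelForm J g g ≤ κ * ∫ x, g x * g x)
    (hκ0 : 0 ≤ κ) (hΩ : IsOpen Ω) (hb : Bornology.IsBounded Ω)
    (hvol : volume Ω = volume (Metric.ball (0 : 𝔼) r) + volume (Metric.ball (0 : 𝔼) r))
    (h : IsSecondEigenvalue J Ω lam) : 1 - lam ≤ κ := by
  obtain ⟨u₁, u₂, lam₁, hu₁, hu₂, horth, hle, hmax⟩ := h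
  by_contra! hlt
  have hpos : 0 < 1 - lam := hκ0.trans_lt hlt
  rw [abs_of_pos hpos] at hle
  rcases le_or_gt 0 (1 - lam₁) with h1 | h1
  · rw [abs_of_nonneg h1] at hle
    obtain ⟨v₂, hv₂, hE₂, hn₂, hV₂⟩ := hu₂.exists_nonneg hJ hN hr hκ hκ0 hΩ hb hvol hlt
    obtain ⟨v₁, hv₁, hE₁, hn₁, hV₁⟩ :=
      hu₁.exists_nonneg hJ hN hr hκ hκ0 hΩ hb hvol (hlt.trans_le hle)
    have horth' : ∫ x, v₁ x * v₂ x = 0 := by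
      rcases hv₁ with rfl | rfl <;> rcases hv₂ with rfl | rfl <;>
        simp [integral_neg, horth]
    have hnn : 0 ≤ᵐ[volume] fun x => v₁ x * v₂ x := by
      filter_upwards [hn₁, hn₂] with x hx hx'
      exact mul_nonneg hx hx'
    rw [integral_eq_zero_iff_of_nonneg_ae hnn (hE₁.supportedL2.integrable_mul hE₂.supportedL2)]
      at horth'
    rcases volume_pos_le_or_le hvol hE₁.supportedL2 hE₂.supportedL2 (by
      filter_upwards [horth'] with x hx hx'
      exact (mul_pos hx'.1 hx'.2).ne' hx) with h | h
    · exact not_lt.2 h hV₁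
    · exact not_lt.2 h hV₂
  -- Case `μ₁ < 0`. Testing with `|u₁|` shows that the eigenvalue of largest modulus beats `|μ₁| ≥
  -- |μ₂|`. It differs from both, so its eigenfunction is orthogonal to `u₁` and `u₂`, against the
  -- maximality of the enumeration.
  · obtain ⟨v, lam', hv, -, hv'⟩ := exists_isEigenfunction_abs_kernelForm_le hJ hN hb
      hΩ.measurableSet (U := ∅) (by simp) hu₁.supportedL2 hu₁.ne_zero (by simp)
    have h2 := hv' _ hu₁.supportedL2.abs (by simp)
    have h3 := hu₁.supportedL2.neg_kernelForm_lt_kernelForm_abs hJ hb hu₁.ne_zero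
    have h4 := hu₁.supportedL2.integral_mul_self_pos hu₁.ne_zero
    rw [hu₁.kernelForm_eq hJ hb hu₁.supportedL2] at h3
    simp only [abs_mul_abs_self] at h2
    have h5 : |1 - lam₁| < |1 - lam'| := by
      rw [abs_of_neg h1]
      have := (le_abs_self _).trans h2
      nlinarith
    have hne₁ : lam₁ ≠ lam' := fun h => by rw [h] at h5; exact lt_irrefl _ h5
    have hne₂ : lam ≠ lam' := fun h => by
      rw [← h, abs_of_pos hpos] at h5; exact not_lt.2 hle h5
    have h6 := hmax v lam' hv (hu₁.integral_mul_eq_zero hJ hb hv hne₁)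
      (hu₂.integral_mul_eq_zero hJ hb hv hne₂)
    rw [abs_of_pos hpos] at h6
    linarith

/-- Remove from `v` its component `t u₂`. The remainder is orthogonal to both eigenfunctions, hence
controlled by `|μ₂|`; the `u₂` component contributes exactly `μ₂ t² ∫ u₂²`, and the mixed terms
vanish. -/
theorem IsSecondEigenvalue.exists_abs_kernelForm_le (hJ : HypothesisH J) (hN : 1 ≤ N)
    (hm : MeasurableSet Ω) (hb : Bornology.IsBounded Ω) (h : IsSecondEigenvalue J Ω lam) :
    ∃ u₁ u₂, SupportedL2 Ω u₁ ∧ IsEigenfunction J Ω u₂ lam ∧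
      ∀ v, SupportedL2 Ω v → ∫ x, u₁ x * v x = 0 →
        |kernelForm J v v| ≤ |1 - lam| * ∫ x, v x * v x := by
  obtain ⟨u₁, u₂, lam₁, hu₁, hu₂, horth, hle, hmax⟩ := h
  refine ⟨u₁, u₂, hu₁.supportedL2, hu₂, fun v hv hv₁ => ?_⟩
  have hn := hu₂.supportedL2.integral_mul_self_pos hu₂.ne_zero
  set n := ∫ x, u₂ x * u₂ x
  set t := (∫ x, u₂ x * v x) / n with ht
  have htn : ∫ x, u₂ x * v x = t * n := (div_mul_cancel₀ _ hn.ne').symm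
  have hvt : ∫ x, v x * u₂ x = t * n := by simpa only [mul_comm] using htn
  have hw := (hv.const_mul 1).add (hu₂.supportedL2.const_mul (-t))
  have hw₁ : ∫ x, u₁ x * (1 * v x + -t * u₂ x) = 0 := by
    rw [SupportedL2.integral_lin_comb hv hu₂.supportedL2 hu₁.supportedL2, hv₁, horth]; ring
  have hw₂ : ∫ x, u₂ x * (1 * v x + -t * u₂ x) = 0 := by
    rw [SupportedL2.integral_lin_comb hv hu₂.supportedL2 hu₂.supportedL2, htn]; ring
  have hQ := kernelForm_lin_comb_self hJ (hv.integrable hb) (hu₂.supportedL2.integrable hb) 1 (-t)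
  rw [kernelForm_comm hJ v u₂, hu₂.kernelForm_eq hJ hb hv,
    hu₂.kernelForm_eq hJ hb hu₂.supportedL2, htn] at hQ
  have hNw := SupportedL2.integral_lin_comb_self hv hu₂.supportedL2 1 (-t)
  rw [hvt] at hNw
  have hbound : |kernelForm J (fun x => 1 * v x + -t * u₂ x) (fun x => 1 * v x + -t * u₂ x)| ≤
      |1 - lam| * ∫ x, (1 * v x + -t * u₂ x) * (1 * v x + -t * u₂ x) := by
    by_cases h0 : (fun x => 1 * v x + -t * u₂ x) =ᵐ[volume] 0
    · rw [kernelForm_congr_ae h0 h0]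
      have : kernelForm J (0 : 𝔼 → ℝ) 0 = 0 := by simp [kernelForm]
      rw [this, abs_zero]
      exact mul_nonneg (abs_nonneg _) (integral_nonneg fun _ => mul_self_nonneg _)
    · obtain ⟨z, lam', hz, hzU, hz'⟩ := exists_isEigenfunction_abs_kernelForm_le hJ hN hb hm
        (U := {u₁, u₂}) (by
          rintro u (rfl | rfl)
          exacts [⟨_, hu₁⟩, ⟨_, hu₂⟩]) hw h0 (by
          rintro u (rfl | rfl)
          exacts [hw₁, hw₂])
      refine (hz' _ hw ?_).trans (mul_le_mul_of_nonneg_right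
        (hmax z lam' hz (hzU _ (by simp)) (hzU _ (by simp)))
        (integral_nonneg fun _ => mul_self_nonneg _))
      rintro u (rfl | rfl)
      exacts [hw₁, hw₂]
  rw [hQ, hNw] at hbound
  have h1 : kernelForm J v v = (1 ^ 2 * kernelForm J v v + 2 * (1 * -t) * ((1 - lam) * (t * n)) +
      (-t) ^ 2 * ((1 - lam) * n)) + (1 - lam) * (t ^ 2 * n) := by ring
  rw [h1]
  refine (abs_add_le _ _).trans ?_
  have h2 : |(1 - lam) * (t ^ 2 * n)| = |1 - lam| * (t ^ 2 * n) := by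
    rw [abs_mul, abs_of_nonneg (show 0 ≤ t ^ 2 * n by positivity)]
  rw [h2]
  change _ ≤ |1 - lam| * _ at hbound
  nlinarith

end SecondEigenvalue

/-! ### Existence of second eigenvalues, and two distant balls. -/

section TwoBalls

open Filter Topology

variable {N : ℕ}

local notation "𝔼" => EuclideanSpace ℝ (Fin N)

variable {J f g : EuclideanSpace ℝ (Fin N) → ℝ} {Ω A B : Set (EuclideanSpace ℝ (Fin N))}
  {r c κ lam : ℝ}

/-- Indicators of two disjoint balls in `Ω` span a plane, so a nonzero vector orthogonal to the
first eigenfunction exists and the extremal problem can be solved again there. The eigenvalue found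
may be `μ₂ = 0`. -/
theorem exists_isSecondEigenvalue (hJ : HypothesisH J) (hN : 1 ≤ N) (hΩ : IsOpen Ω)
    (hb : Bornology.IsBounded Ω) (hne : Ω.Nonempty) : ∃ lam, IsSecondEigenvalue J Ω lam := by
  have hm := hΩ.measurableSet
  obtain ⟨x, hx⟩ := hne
  obtain ⟨ρ, hρ, hball⟩ := Metric.isOpen_iff.1 hΩ x hx
  have : Nonempty (Fin N) := ⟨⟨0, hN⟩⟩
  -- Centres at distance `ρ / 2` and radii `ρ / 4` give disjoint balls, both inside the ball of
  -- radius `ρ` about `x`.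
  obtain ⟨y, hy⟩ : ∃ y : 𝔼, ‖y‖ = ρ / 2 := exists_norm_eq _ (by positivity)
  have hind : ∀ z : 𝔼, SupportedL2 (Metric.ball z (ρ / 4))
      ((Metric.ball z (ρ / 4)).indicator fun _ => (1 : ℝ)) := fun z =>
    ⟨memLp_indicator_const 2 measurableSet_ball 1 (Or.inr measure_ball_lt_top.ne),
      fun _ hx => Set.indicator_of_notMem hx _⟩
  have hsub₁ : Metric.ball x (ρ / 4) ⊆ Ω := (Metric.ball_subset_ball (by linarith)).trans hball
  have hsub₂ : Metric.ball (x + y) (ρ / 4) ⊆ Ω := by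
    refine (Metric.ball_subset_ball' ?_).trans hball
    rw [dist_eq_norm, add_sub_cancel_left, hy]
    linarith
  set f := (Metric.ball x (ρ / 4)).indicator fun _ => (1 : ℝ) with hf_def
  set g := (Metric.ball (x + y) (ρ / 4)).indicator fun _ => (1 : ℝ) with hg_def
  have hf : SupportedL2 Ω f := (hind x).mono hsub₁
  have hg : SupportedL2 Ω g := (hind (x + y)).mono hsub₂
  have hself : ∀ z : 𝔼, 0 < ∫ t, (Metric.ball z (ρ / 4)).indicator (fun _ => (1 : ℝ)) t *
      (Metric.ball z (ρ / 4)).indicator (fun _ => (1 : ℝ)) t := fun z => by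
    have : ∀ t, (Metric.ball z (ρ / 4)).indicator (fun _ => (1 : ℝ)) t *
      (Metric.ball z (ρ / 4)).indicator (fun _ => (1 : ℝ)) t =
        (Metric.ball z (ρ / 4)).indicator 1 t := fun t => by
      by_cases h : t ∈ Metric.ball z (ρ / 4) <;> simp [h]
    simp only [this]
    rw [integral_indicator_one measurableSet_ball]
    exact ENNReal.toReal_pos (Metric.measure_ball_pos _ _ (by positivity)).ne'
      measure_ball_lt_top.ne
  have hdisj : Disjoint (Metric.ball x (ρ / 4)) (Metric.ball (x + y) (ρ / 4)) := by
    apply Metric.ball_disjoint_ball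
    rw [dist_eq_norm, sub_add_cancel_left, norm_neg, hy]
    linarith
  have hfg : ∫ t, f t * g t = 0 := by
    refine integral_eq_zero_of_ae (.of_forall fun t => ?_)
    by_cases h : t ∈ Metric.ball x (ρ / 4)
    · simp [hg_def, Set.indicator_of_notMem (Set.disjoint_left.1 hdisj h)]
    · simp [hf_def, Set.indicator_of_notMem h]
  have hcomb : ∀ a b : ℝ, ¬ (a = 0 ∧ b = 0) → ¬ (fun t => a * f t + b * g t) =ᵐ[volume] 0 := by
    intro a b hab h0
    have h1 : ∫ t, (a * f t + b * g t) * (a * f t + b * g t) = 0 := by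
      refine integral_eq_zero_of_ae ?_
      filter_upwards [h0] with t ht
      simp [show a * f t + b * g t = 0 from ht]
    rw [SupportedL2.integral_lin_comb_self hf hg, hfg] at h1
    have h2 := hself x
    have h3 := hself (x + y)
    have ha := mul_nonneg (sq_nonneg a) h2.le
    have hb := mul_nonneg (sq_nonneg b) h3.le
    refine hab ⟨?_, ?_⟩
    · have : a ^ 2 * ∫ t, f t * f t = 0 := by linarith
      exact pow_eq_zero_iff two_ne_zero |>.1 ((mul_eq_zero.1 this).resolve_right h2.ne')
    · have : b ^ 2 * ∫ t, g t * g t = 0 := by linarith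
      exact pow_eq_zero_iff two_ne_zero |>.1 ((mul_eq_zero.1 this).resolve_right h3.ne')
  have hf0 : ¬ f =ᵐ[volume] 0 := by simpa using! hcomb 1 0 (by simp)
  obtain ⟨u₁, lam₁, hu₁, -, h₁⟩ := exists_isEigenfunction_abs_kernelForm_le hJ hN hb hm
    (U := ∅) (by simp) hf hf0 (by simp)
  obtain ⟨a, b, hab, hab₁⟩ : ∃ a b : ℝ, ¬ (a = 0 ∧ b = 0) ∧
      ∫ t, u₁ t * (a * f t + b * g t) = 0 := by
    by_cases hz : ∫ t, u₁ t * f t = 0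
    · refine ⟨1, 0, by simp, ?_⟩
      rw [SupportedL2.integral_lin_comb hf hg hu₁.supportedL2, hz]; ring
    · refine ⟨∫ t, u₁ t * g t, -∫ t, u₁ t * f t, fun h => hz (neg_eq_zero.1 h.2), ?_⟩
      rw [SupportedL2.integral_lin_comb hf hg hu₁.supportedL2]; ring
  obtain ⟨u₂, lam₂, hu₂, hu₂₁, h₂⟩ := exists_isEigenfunction_abs_kernelForm_le hJ hN hb hm
    (U := {u₁}) (by rintro u rfl; exact ⟨_, hu₁⟩) ((hf.const_mul a).add (hg.const_mul b))
    (hcomb a b hab) (by rintro u rfl; exact hab₁)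
  have habs : ∀ {v lam' C}, IsEigenfunction J Ω v lam' →
      |kernelForm J v v| ≤ C * ∫ x, v x * v x → |1 - lam'| ≤ C := fun {v lam' C} hv h => by
    have hn := hv.supportedL2.integral_mul_self_pos hv.ne_zero
    rw [hv.kernelForm_eq hJ hb hv.supportedL2, abs_mul, abs_of_pos hn] at h
    exact le_of_mul_le_mul_right h hn
  refine ⟨lam₂, u₁, u₂, lam₁, hu₁, hu₂, hu₂₁ u₁ rfl, habs hu₂ (h₁ _ hu₂.supportedL2 (by simp)),
    fun v lam hv hv₁ _ => habs hv (h₂ v hv.supportedL2 (by rintro u rfl; exact hv₁))⟩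

/-- The principal eigenvalue `κ` of the convolution operator on a ball, and the gap between `-κ` and
the rest of the spectrum. -/
theorem exists_principal_eigenvalue_ball (hJ : HypothesisH J) (hN : 1 ≤ N) (hr : 0 < r) :
    ∃ κ > 0, ∃ δ > 0, (∀ g, SupportedL2 (Metric.ball (0 : 𝔼) r) g →
        kernelForm J g g ≤ κ * ∫ x, g x * g x) ∧
      (∀ g, SupportedL2 (Metric.ball (0 : 𝔼) r) g →
        -(κ - δ) * (∫ x, g x * g x) ≤ kernelForm J g g) ∧
      ∃ φ, SupportedL2 (Metric.ball (0 : 𝔼) r) φ ∧ 0 < ∫ x, φ x * φ x ∧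
        kernelForm J φ φ = κ * ∫ x, φ x * φ x := by
  have hb : Bornology.IsBounded (Metric.ball (0 : 𝔼) r) := Metric.isBounded_ball
  have hm : MeasurableSet (Metric.ball (0 : 𝔼) r) := measurableSet_ball
  set f : 𝔼 → ℝ := (Metric.ball (0 : 𝔼) r).indicator fun _ => (1 : ℝ)
  have hf : SupportedL2 (Metric.ball (0 : 𝔼) r) f :=
    ⟨memLp_indicator_const 2 measurableSet_ball 1 (Or.inr measure_ball_lt_top.ne),
      fun _ hx => Set.indicator_of_notMem hx _⟩
  have hf0 : ¬ f =ᵐ[volume] 0 := fun h => by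
    refine (Metric.measure_ball_pos volume (0 : 𝔼) hr).ne' (measure_mono_null (fun x hx => ?_)
      (ae_iff.1 h))
    change ¬ f x = 0
    simp [f, Set.indicator_of_mem hx]
  obtain ⟨φ, lam, hφ, -, hle⟩ := exists_isEigenfunction_abs_kernelForm_le hJ hN hb hm
    (U := ∅) (by simp) hf hf0 (by simp)
  replace hle := fun g hg => hle g hg (by simp)
  have hφn := hφ.supportedL2.integral_mul_self_pos hφ.ne_zero
  have hκ : 0 < |1 - lam| := by
    have h1 := kernelForm_self_pos hJ (hf.integrable hb)
      (fun x => Set.indicator_nonneg (fun _ _ => zero_le_one) x) hf0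
    have h2 := (le_abs_self _).trans (hle f hf)
    exact pos_of_mul_pos_left (h1.trans_le h2) (integral_nonneg fun _ => mul_self_nonneg _)
  -- An eigenvalue `-κ` would give `Q(|u|) > κ ∫ u²`, above the maximum. This both fixes the sign of
  -- the extremal eigenvalue and yields the gap `δ`.
  have hne : ∀ u lam', IsEigenfunction J (Metric.ball (0 : 𝔼) r) u lam' →
      1 - lam' ≠ -|1 - lam| := fun u lam' hu h => by
    have h1 := hu.supportedL2.neg_kernelForm_lt_kernelForm_abs hJ hb hu.ne_zero
    have h2 := (le_abs_self _).trans (hle _ hu.supportedL2.abs)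
    rw [hu.kernelForm_eq hJ hb hu.supportedL2, h] at h1
    simp only [abs_mul_abs_self] at h2
    linarith
  obtain ⟨δ, hδ, hgap⟩ := exists_neg_le_kernelForm hJ hN hb hm hκ hle hne
  refine ⟨_, hκ, δ, hδ, fun g hg => (le_abs_self _).trans (hle g hg), hgap, φ, hφ.supportedL2, hφn,
    ?_⟩
  rw [hφ.kernelForm_eq hJ hb hφ.supportedL2]
  rcases abs_choice (1 - lam) with h | h
  · rw [h]
  · exact absurd (by rw [h, neg_neg]) (hne φ lam hφ)

/-- Bound `J` by `s` and `|f(x) g(y)|` by `(f(x)² + g(y)²) / 2` on `A × B`; integrating the absent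
variable costs a volume. The factor `2` matches the cross term of the quadratic form. -/
theorem abs_kernelForm_le_of_le (hJ : HypothesisH J) (hA : MeasurableSet A) (hB : MeasurableSet B)
    (hAb : Bornology.IsBounded A) (hBb : Bornology.IsBounded B) {V s : ℝ}
    (hVA : volume.real A ≤ V) (hVB : volume.real B ≤ V) (hs0 : 0 ≤ s)
    (hs : ∀ x ∈ A, ∀ y ∈ B, J (x - y) ≤ s) (hf : SupportedL2 A f) (hg : SupportedL2 B g) :
    2 * |kernelForm J f g| ≤ s * V * ((∫ x, f x * f x) + ∫ x, g x * g x) := by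
  have hind : ∀ {S : Set 𝔼}, MeasurableSet S → Bornology.IsBounded S →
      Integrable (S.indicator fun _ => (1 : ℝ)) := fun hS hSb =>
    (integrable_indicator_iff hS).2 (integrableOn_const hSb.measure_lt_top.ne)
  have i₁ : Integrable fun p : 𝔼 × 𝔼 => (f p.1 * f p.1) * B.indicator (fun _ => (1 : ℝ)) p.2 :=
    (hf.integrable_mul hf).mul_prod (hind hB hBb)
  have i₂ : Integrable fun p : 𝔼 × 𝔼 => A.indicator (fun _ => (1 : ℝ)) p.1 * (g p.2 * g p.2) :=
    (hind hA hAb).mul_prod (hg.integrable_mul hg)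
  have hint := hJ.integrable_kernel (hf.integrable hAb) (hg.integrable hBb)
  have hi : ∀ {S : Set 𝔼}, MeasurableSet S → ∫ x, S.indicator (fun _ => (1 : ℝ)) x = volume.real S :=
    fun hS => integral_indicator_one hS
  have h1 : |kernelForm J f g| ≤ ∫ p : 𝔼 × 𝔼, s / 2 *
      ((f p.1 * f p.1) * B.indicator (fun _ => (1 : ℝ)) p.2 +
        A.indicator (fun _ => (1 : ℝ)) p.1 * (g p.2 * g p.2)) := by
    rw [← Real.norm_eq_abs, kernelForm]
    refine norm_integral_le_of_norm_le ((i₁.add i₂).const_mul _) (.of_forall fun p => ?_)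
    by_cases hp : p.1 ∈ A ∧ p.2 ∈ B
    · rw [Set.indicator_of_mem hp.1, Set.indicator_of_mem hp.2, norm_mul, norm_mul,
        Real.norm_of_nonneg (hJ.nonneg _), Real.norm_eq_abs, Real.norm_eq_abs]
      have hJs := hs _ hp.1 _ hp.2
      have h2 : |f p.1| * |g p.2| ≤ (f p.1 * f p.1 + g p.2 * g p.2) / 2 := by
        rw [← abs_mul_abs_self (f p.1), ← abs_mul_abs_self (g p.2)]
        nlinarith [sq_nonneg (|f p.1| - |g p.2|)]
      have h3 : 0 ≤ |f p.1| * |g p.2| := by positivity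
      nlinarith [mul_le_mul_of_nonneg_right hJs h3, mul_le_mul_of_nonneg_left h2 hs0]
    · have h0 : f p.1 = 0 ∨ g p.2 = 0 := by
        by_contra! h
        exact hp ⟨by_contra fun h' => h.1 (hf.eq_zero_of_notMem _ h'),
          by_contra fun h' => h.2 (hg.eq_zero_of_notMem _ h')⟩
      have h4 : f p.1 * J (p.1 - p.2) * g p.2 = 0 := by rcases h0 with h | h <;> simp [h]
      rw [h4, norm_zero]
      have h5 : 0 ≤ B.indicator (fun _ => (1 : ℝ)) p.2 :=
        Set.indicator_nonneg (fun _ _ => zero_le_one) _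
      have h6 : 0 ≤ A.indicator (fun _ => (1 : ℝ)) p.1 :=
        Set.indicator_nonneg (fun _ _ => zero_le_one) _
      have h7 := mul_self_nonneg (f p.1)
      have h8 := mul_self_nonneg (g p.2)
      positivity
  have e₁ : ∫ p : 𝔼 × 𝔼, (f p.1 * f p.1) * B.indicator (fun _ => (1 : ℝ)) p.2 =
      (∫ x, f x * f x) * volume.real B := by
    rw [← hi hB]
    exact integral_prod_mul (fun x => f x * f x) (B.indicator fun _ => (1 : ℝ))
  have e₂ : ∫ p : 𝔼 × 𝔼, A.indicator (fun _ => (1 : ℝ)) p.1 * (g p.2 * g p.2) =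
      volume.real A * ∫ x, g x * g x := by
    rw [← hi hA]
    exact integral_prod_mul (A.indicator fun _ => (1 : ℝ)) (fun x => g x * g x)
  rw [integral_const_mul, integral_add i₁ i₂, e₁, e₂] at h1
  have hfn : 0 ≤ ∫ x, f x * f x := integral_nonneg fun _ => mul_self_nonneg _
  have hgn : 0 ≤ ∫ x, g x * g x := integral_nonneg fun _ => mul_self_nonneg _
  nlinarith [mul_le_mul_of_nonneg_left (add_le_add (mul_le_mul_of_nonneg_left hVB hfn)
    (mul_le_mul_of_nonneg_right hVA hgn)) hs0]

theorem SupportedL2.integral_mul_eq_zero_of_disjoint (hf : SupportedL2 A f) (hg : SupportedL2 B g)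
    (h : Disjoint A B) : ∫ x, f x * g x = 0 := by
  refine integral_eq_zero_of_ae (.of_forall fun x => ?_)
  by_cases hx : x ∈ A
  · simp [hg.eq_zero_of_notMem x (Set.disjoint_left.1 h hx)]
  · simp [hf.eq_zero_of_notMem x hx]

theorem SupportedL2.translate_ball {a : 𝔼} (hf : SupportedL2 (Metric.ball a r) f) (b : 𝔼) :
    SupportedL2 (Metric.ball (a - b) r) (fun x => f (x + b)) := by
  have := hf.translate b
  rwa [show (fun x => x + b) ⁻¹' Metric.ball a r = Metric.ball (a - b) r by
    ext x
    simp only [Set.mem_preimage, Metric.mem_ball, dist_eq_norm]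
    rw [sub_sub_eq_add_sub]] at this

/-- The second eigenvalue of two balls far apart is close to the principal eigenvalue of one. -/
theorem IsSecondEigenvalue.le_one_sub_of_two_balls (hJ : HypothesisH J) (hN : 1 ≤ N) {κ δ V s : ℝ}
    (hgap : ∀ g, SupportedL2 (Metric.ball (0 : 𝔼) r) g →
        -(κ - δ) * (∫ x, g x * g x) ≤ kernelForm J g g)
    {φ : 𝔼 → ℝ} (hφ : SupportedL2 (Metric.ball (0 : 𝔼) r) φ) (hφ0 : 0 < ∫ x, φ x * φ x)
    (hφκ : kernelForm J φ φ = κ * ∫ x, φ x * φ x) {a b : 𝔼}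
    (hd : Disjoint (Metric.ball a r) (Metric.ball b r))
    (hV : ∀ z : 𝔼, volume.real (Metric.ball z r) ≤ V) (hs0 : 0 ≤ s)
    (hs : ∀ x ∈ Metric.ball a r, ∀ y ∈ Metric.ball b r, J (x - y) ≤ s)
    (hδ : 2 * (s * V) < δ)
    (h : IsSecondEigenvalue J (Metric.ball a r ∪ Metric.ball b r) lam) :
    κ - s * V ≤ 1 - lam := by
  have hbd : ∀ z : 𝔼, Bornology.IsBounded (Metric.ball z r) := fun z => Metric.isBounded_ball
  have hm : ∀ z : 𝔼, MeasurableSet (Metric.ball z r) := fun z => measurableSet_ball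
  -- The norm splits exactly over the two balls and the form splits up to the interaction error `s *
  -- V`.
  have hdecomp : ∀ {f g : 𝔼 → ℝ}, SupportedL2 (Metric.ball a r) f →
      SupportedL2 (Metric.ball b r) g →
      (∫ x, (1 * f x + 1 * g x) * (1 * f x + 1 * g x) =
        (∫ x, f x * f x) + ∫ x, g x * g x) ∧
      |kernelForm J (fun x => 1 * f x + 1 * g x) (fun x => 1 * f x + 1 * g x) -
        (kernelForm J f f + kernelForm J g g)| ≤
        s * V * ((∫ x, f x * f x) + ∫ x, g x * g x) := by
    intro f g hf hg
    constructor
    · rw [SupportedL2.integral_lin_comb_self hf hg, hf.integral_mul_eq_zero_of_disjoint hg hd]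
      ring
    · rw [kernelForm_lin_comb_self hJ (hf.integrable (hbd a)) (hg.integrable (hbd b))]
      refine le_trans (le_of_eq ?_) (abs_kernelForm_le_of_le hJ (hm a) (hm b) (hbd a) (hbd b)
        (hV a) (hV b) hs0 hs hf hg)
      rw [← abs_two, ← abs_mul, abs_two]
      congr 1
      ring
  obtain ⟨u₁, u₂, hu₁, hu₂, hbound⟩ :=
    h.exists_abs_kernelForm_le hJ hN ((hm a).union (hm b)) ((hbd a).union (hbd b))
  -- Min-max: some combination of the two translates of `φ` is orthogonal to `u₁`, and its Rayleigh
  -- quotient is at least `κ - s V`.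
  have hlower : κ - s * V ≤ |1 - lam| := by
    have hφt : ∀ z : 𝔼, SupportedL2 (Metric.ball z r) (fun x => φ (x + -z)) := fun z => by
      simpa using hφ.translate_ball (-z)
    have hφn : ∀ z : 𝔼, ∫ x, φ (x + -z) * φ (x + -z) = ∫ x, φ x * φ x := fun z =>
      integral_add_right_eq_self (fun x => φ x * φ x) (-z)
    have hφQ : ∀ z : 𝔼, kernelForm J (fun x => φ (x + -z)) (fun x => φ (x + -z)) =
        κ * ∫ x, φ x * φ x := fun z => by rw [kernelForm_translate, hφκ]
    have hφa := (hφt a).mono Set.subset_union_left (Ω' := Metric.ball a r ∪ Metric.ball b r)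
    have hφb := (hφt b).mono Set.subset_union_right (Ω' := Metric.ball a r ∪ Metric.ball b r)
    obtain ⟨α, β, hαβ, horth⟩ : ∃ α β : ℝ, 0 < α ^ 2 + β ^ 2 ∧
        ∫ t, u₁ t * (α * φ (t + -a) + β * φ (t + -b)) = 0 := by
      by_cases hz : ∫ t, u₁ t * φ (t + -a) = 0
      · refine ⟨1, 0, by norm_num, ?_⟩
        rw [SupportedL2.integral_lin_comb hφa hφb hu₁, hz]; ring
      · refine ⟨∫ t, u₁ t * φ (t + -b), -∫ t, u₁ t * φ (t + -a),
          add_pos_of_nonneg_of_pos (sq_nonneg _) (sq_pos_iff.2 (neg_ne_zero.2 hz)), ?_⟩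
        rw [SupportedL2.integral_lin_comb hφa hφb hu₁]; ring
    obtain ⟨hn, hQ⟩ := hdecomp ((hφt a).const_mul α) ((hφt b).const_mul β)
    have hv := hbound (fun x => 1 * (α * φ (x + -a)) + 1 * (β * φ (x + -b)))
      (((hφa.const_mul α).const_mul 1).add ((hφb.const_mul β).const_mul 1))
      (by simpa only [one_mul] using horth)
    have hsq : ∀ (γ : ℝ) (z : 𝔼), ∫ x, γ * φ (x + -z) * (γ * φ (x + -z)) =
        γ ^ 2 * ∫ x, φ x * φ x := fun γ z => by
      rw [← hφn z, ← integral_const_mul]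
      refine integral_congr_ae (.of_forall fun x => ?_)
      simp only; ring
    rw [hn] at hv
    rw [kernelForm_smul_left, kernelForm_smul_right, kernelForm_smul_left, kernelForm_smul_right,
      hφQ, hφQ] at hQ
    rw [hsq, hsq] at hQ hv
    have h1 := (abs_le.1 hQ).1
    have h2 := (le_abs_self _).trans hv
    have h3 : 0 < (α ^ 2 + β ^ 2) * ∫ x, φ x * φ x := mul_pos hαβ hφ0
    refine le_of_mul_le_mul_right ?_ h3
    linarith
  rcases le_or_gt 0 (1 - lam) with hpos | hneg
  · rwa [abs_of_nonneg hpos] at hlower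
  -- A negative `μ₂` would satisfy `μ₂ ≤ -κ + s V`. Splitting `u₂` over the balls and using the gap
  -- on each gives `μ₂ ≥ -(κ - δ) - s V`, so `δ ≤ 2 s V`.
  exfalso
  rw [abs_of_neg hneg] at hlower
  have hfa : SupportedL2 (Metric.ball a r) ((Metric.ball a r).indicator u₂) :=
    .indicator hu₂.memLp (hm a)
  have hfb : SupportedL2 (Metric.ball b r) ((Metric.ball b r).indicator u₂) :=
    .indicator hu₂.memLp (hm b)
  have heq : u₂ =ᵐ[volume] fun x => 1 * (Metric.ball a r).indicator u₂ x +
      1 * (Metric.ball b r).indicator u₂ x := .of_forall fun x => by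
    by_cases hxa : x ∈ Metric.ball a r
    · simp [Set.indicator_of_mem hxa,
        Set.indicator_of_notMem (Set.disjoint_left.1 hd hxa)]
    · by_cases hxb : x ∈ Metric.ball b r
      · simp [Set.indicator_of_mem hxb, Set.indicator_of_notMem hxa]
      · simp only [Set.indicator_of_notMem hxa, Set.indicator_of_notMem hxb]
        rw [hu₂.eq_zero_of_notMem x (by simp [hxa, hxb])]; ring
  obtain ⟨hn, hQ⟩ := hdecomp hfa hfb
  have hgap' : ∀ {z : 𝔼} {f : 𝔼 → ℝ}, SupportedL2 (Metric.ball z r) f →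
      -(κ - δ) * (∫ x, f x * f x) ≤ kernelForm J f f := fun {z f} hf => by
    have h1 := hgap _ (by simpa using hf.translate_ball z)
    rwa [kernelForm_translate,
      integral_add_right_eq_self (fun x => f x * f x) z] at h1
  have h1 := hgap' hfa
  have h2 := hgap' hfb
  have h3 := (abs_le.1 hQ).1
  have hsq := integral_congr_ae (heq.mul heq)
  simp only [Pi.mul_apply] at hsq
  rw [← hn, ← hsq, ← kernelForm_congr_ae heq heq,
    hu₂.kernelForm_eq hJ ((hbd a).union (hbd b)) hu₂.supportedL2] at h3
  rw [hn] at hsq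
  have hpos := hu₂.supportedL2.integral_mul_self_pos hu₂.ne_zero
  rw [hsq] at h3 hpos
  set n := (∫ x, (Metric.ball a r).indicator u₂ x * (Metric.ball a r).indicator u₂ x) +
    ∫ x, (Metric.ball b r).indicator u₂ x * (Metric.ball b r).indicator u₂ x
  have h4 : -(κ - δ) * n - s * V * n ≤ (1 - lam) * n := by
    simp only [n] at h3 ⊢
    linarith
  have h5 : (-(κ - δ) - s * V) * n ≤ (1 - lam) * n := by linarith
  have h6 := le_of_mul_le_mul_right h5 hpos
  linarith

theorem exists_ball_volume (hN : 1 ≤ N) (hc : 0 < c) :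
    ∃ r > 0, ∀ z : 𝔼, volume (Metric.ball z r) = ENNReal.ofReal (c / 2) := by
  have h1 : 0 < volume.real (Metric.ball (0 : 𝔼) 1) :=
    ENNReal.toReal_pos (Metric.measure_ball_pos _ _ one_pos).ne' measure_ball_lt_top.ne
  set v := volume.real (Metric.ball (0 : 𝔼) 1) with hv
  have hpos : 0 < c / 2 / v := by positivity
  refine ⟨(c / 2 / v) ^ ((N : ℝ)⁻¹), Real.rpow_pos_of_pos hpos _, fun z => ?_⟩
  rw [Measure.addHaar_ball_of_pos _ _ (Real.rpow_pos_of_pos hpos _), finrank_euclideanSpace_fin,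
    Real.rpow_inv_natCast_pow hpos.le (by omega),
    ← ENNReal.ofReal_toReal (measure_ball_lt_top (μ := volume) (x := (0 : 𝔼)) (r := 1)).ne,
    ← ENNReal.ofReal_mul hpos.le]
  change ENNReal.ofReal (c / 2 / v * v) = _
  rw [div_mul_cancel₀ _ h1.ne']

end TwoBalls

/-! ### Identification of the infimum with `1 - κ`. -/

theorem corollary2p5 {N : ℕ} (hN : 1 ≤ N) (J : EuclideanSpace ℝ (Fin N) → ℝ)
    (hJ : HypothesisH J) (c : ℝ) (hc : 0 < c) :
    (∀ Ω : Set (EuclideanSpace ℝ (Fin N)), IsAdmissible c Ω → ∃ lam, IsSecondEigenvalue J Ω lam) ∧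
    ∃ m r : ℝ,
      IsGLB {lam : ℝ | ∃ Ω : Set (EuclideanSpace ℝ (Fin N)),
        IsAdmissible c Ω ∧ IsSecondEigenvalue J Ω lam} m ∧
      0 < r ∧
      (∀ a b : EuclideanSpace ℝ (Fin N), 2 * r ≤ dist a b →
        Disjoint (Metric.ball a r) (Metric.ball b r) ∧
        IsAdmissible c (Metric.ball a r ∪ Metric.ball b r)) ∧
      ∀ ε > 0, ∃ R ≥ 2 * r, ∀ a b : EuclideanSpace ℝ (Fin N), R ≤ dist a b →
        ∀ lam, IsSecondEigenvalue J (Metric.ball a r ∪ Metric.ball b r) lam → |lam - m| < ε := by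
  have hex : ∀ Ω : Set (EuclideanSpace ℝ (Fin N)), IsAdmissible c Ω →
      ∃ lam, IsSecondEigenvalue J Ω lam := fun Ω hΩ => by
    refine exists_isSecondEigenvalue hJ hN hΩ.1 hΩ.2.1 (nonempty_of_measure_ne_zero (μ := volume) ?_)
    rw [hΩ.2.2]
    simpa using hc
  obtain ⟨r, hr, hvol⟩ := exists_ball_volume hN hc
  have hV2 : ∀ z w : EuclideanSpace ℝ (Fin N),
      volume (Metric.ball z r) + volume (Metric.ball w r) = ENNReal.ofReal c := fun z w => by
    rw [hvol, hvol, ← ENNReal.ofReal_add (by positivity) (by positivity), add_halves]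
  obtain ⟨κ, hκ, δ, hδ, hle, hgap, φ, hφ, hφ0, hφκ⟩ :=
    exists_principal_eigenvalue_ball hJ hN hr
  have hballs : ∀ a b : EuclideanSpace ℝ (Fin N), 2 * r ≤ dist a b →
      Disjoint (Metric.ball a r) (Metric.ball b r) ∧
      IsAdmissible c (Metric.ball a r ∪ Metric.ball b r) := fun a b hab => by
    have hd : Disjoint (Metric.ball a r) (Metric.ball b r) :=
      Metric.ball_disjoint_ball (by linarith)
    exact ⟨hd, Metric.isOpen_ball.union Metric.isOpen_ball,
      Metric.isBounded_ball.union Metric.isBounded_ball,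
      by rw [measure_union hd measurableSet_ball, hV2]⟩
  have hlow : ∀ Ω : Set (EuclideanSpace ℝ (Fin N)), IsAdmissible c Ω →
      ∀ lam, IsSecondEigenvalue J Ω lam → 1 - κ ≤ lam := fun Ω hΩ lam h => by
    have := h.one_sub_le hJ hN hr hle hκ.le hΩ.1 hΩ.2.1 (by rw [hΩ.2.2, hV2])
    linarith
  have hlim : ∀ ε > 0, ∃ R ≥ 2 * r, ∀ a b : EuclideanSpace ℝ (Fin N), R ≤ dist a b →
      ∀ lam, IsSecondEigenvalue J (Metric.ball a r ∪ Metric.ball b r) lam →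
        |lam - (1 - κ)| < ε := by
    intro ε hε
    -- `t` is the allowed interaction `s V` with `V = c / 2`: below `ε` for the estimate, below `δ /
    -- 2` to exclude a negative `μ₂`.
    obtain ⟨t, ht, ht'⟩ := exists_between (lt_min hε (half_pos hδ))
    have ht1 := ht'.trans_le (min_le_left _ _)
    have ht2 := ht'.trans_le (min_le_right _ _)
    have hVpos : 0 < c / 2 := half_pos hc
    have hst : t / (c / 2) * (c / 2) = t := div_mul_cancel₀ _ hVpos.ne'
    obtain ⟨R, hR⟩ := hJ.exists_forall_le hN (div_pos ht hVpos)
    -- Points of the two balls are closer than their centres by at most `2 r`, hence still at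
    -- distance at least `R`.
    refine ⟨max (2 * r) (R + 2 * r), le_max_left _ _, fun a b hab lam h => ?_⟩
    obtain ⟨hd, hadm⟩ := hballs a b ((le_max_left _ _).trans hab)
    have h1 := hlow _ hadm lam h
    have h2 := h.le_one_sub_of_two_balls hJ hN (V := c / 2) (s := t / (c / 2)) hgap hφ hφ0 hφκ hd
      (fun z => by rw [Measure.real, hvol, ENNReal.toReal_ofReal hVpos.le])
      (div_pos ht hVpos).le (fun x hx y hy => hR _ (by
        rw [← dist_eq_norm]
        have h3 := (le_max_right _ _).trans hab
        have h4 := dist_triangle4 a x y b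
        rw [Metric.mem_ball] at hx hy
        rw [dist_comm a x] at h4
        linarith)) (by rw [hst]; linarith)
    rw [hst] at h2
    rw [abs_lt]
    constructor <;> linarith
  refine ⟨hex, 1 - κ, r, ⟨?_, ?_⟩, hr, hballs, hlim⟩
  · rintro lam ⟨Ω, hΩ, h⟩
    exact hlow Ω hΩ lam h
  -- Two balls at distance `R` are themselves competitors, so every lower bound is at most `1 - κ +
  -- ε`.
  · intro m hm
    refine le_of_forall_pos_le_add fun ε hε => ?_
    obtain ⟨R, hR, h⟩ := hlim ε hε
    have : Nonempty (Fin N) := ⟨⟨0, hN⟩⟩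
    obtain ⟨a, ha⟩ : ∃ a : EuclideanSpace ℝ (Fin N), ‖a‖ = R := exists_norm_eq _ (by linarith)
    have hdist : dist a 0 = R := by rw [dist_zero_right, ha]
    obtain ⟨-, hadm⟩ := hballs a 0 (by rw [hdist]; exact hR)
    obtain ⟨lam, hlam⟩ := hex _ hadm
    have h1 := hm ⟨_, hadm, hlam⟩
    have h2 := (abs_lt.1 (h a 0 hdist.ge lam hlam)).2
    linarith
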